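/- Let $(F,d)$ be an ordinary differential field of characteristic zero whose derivation $d$ is not identically zero, let $C=\{a\in F: d(a)=0\}$ be its field of constants, let $F^*=F\setminus\{0\}$, let $n>1$ be an integer, and let $H$ be any subgroup of the affine group $GL(n,C)\ltimes C^n$. Let $x=(x_1,\dots,x_n)$ be a column of differential indeterminates over $F$, and let $C\langle x,d\rangle$ be the field of differential rational functions in $x$ over $C$. For $f=f^d\langle x\rangle\in C\langle x,d\rangle$, $g\in F^*$ and $(h,h_0)\in GL(n,C)\ltimes C^n$, let $f^{g^{-1}d}\langle hx+h_0\rangle\in F\langle x,d\rangle$ be obtained from $f$ by replacing every $d^kx_i$ by $(g^{-1}d)^k(hx+h_0)_i$. Put $$C\langle x,d\rangle^{(F^*,H)}=\{f\in C\langle x,d\rangle : f^{g^{-1}d}\langle hx+h_0\rangle=f^d\langle x\rangle\ \text{for all } g\in F^*,\ (h,h_0)\in H\}.$$ Let $p\in C\langle x,d\rangle$ be any nonzero element such that $p^{g^{-1}d}\langle hx+h_0\rangle=g^{-1}p^d\langle x\rangle$ for all $g\in F^*$ and $(h,h_0)\in H$, and let $\delta=p^{-1}d$. Then $\delta$ maps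 the field $C\langle x,d\rangle^{(F^*,H)}$ into itself, and the differential transcendence degree over $C$ of the differential field $(C\langle x,d\rangle^{(F^*,H)},\delta)$ (the supremum of the cardinalities of its $\delta$-algebraically independent subsets) equals $n-1$. -/

import Mathlib

namespace DiffInvariants

open MvPolynomial

noncomputable section

/-! ### Differential transcendence degree -/

/-- Let `(L, δ)` be a differential field over a field `K` of constants. A family `a` of elements of
`L` is differentially algebraically independent over `K` if all the derivatives `δ^k (a i)` together
are algebraically independent over `K`, that is, if no nonzero differential polynomial over `K`
vanishes at `a`. -/
def DiffAlgebraicIndependent {K L ι : Type*} [Field K] [Field L] [Algebra K L]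
    (δ : Derivation K L L) (a : ι → L) : Prop :=
  AlgebraicIndependent K (fun q : ι × ℕ => (δ^[q.2]) (a q.1))

/-- The differential transcendence degree of the differential field `(L, δ)` over `K`: the supremum
of the cardinalities of the differentially algebraically independent subsets of `L`. -/
def diffTrdeg {K L : Type*} [Field K] [Field L] [Algebra K L] (δ : Derivation K L L) : Cardinal :=
  ⨆ s : {s : Set L // DiffAlgebraicIndependent δ (fun a : s => (a : L))}, Cardinal.mk s.1

/-- The restriction of a derivation of a field `E` to an intermediate field that it preserves. -/
def restrictDerivation {K E : Type*} [Field K] [Field E] [Algebra K E] (δ : Derivation K E E)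
    (L : IntermediateField K E) (hL : ∀ f ∈ L, δ f ∈ L) : Derivation K L L :=
  Derivation.mk'
    { toFun := fun f => ⟨δ f, hL f f.2⟩
      map_add' := fun f g => Subtype.ext (by simp)
      map_smul' := fun m f => Subtype.ext (by simp) }
    (fun f g => Subtype.ext (by simp))

/-! ### Extension of a derivation to the field of fractions -/

section Fraction

variable {A : Type*} [CommRing A] [IsDomain A] {R : Type*} [CommRing R] [Algebra R A]

lemma quotient_rule_wellDefined (δ : Derivation R A A) {a b c e : A} (hb : b ≠ 0) (he : e ≠ 0)
    (h : algebraMap A (FractionRing A) a / algebraMap A (FractionRing A) b =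
      algebraMap A (FractionRing A) c / algebraMap A (FractionRing A) e) :
    algebraMap A (FractionRing A) (δ a * b - a * δ b) / algebraMap A (FractionRing A) b ^ 2 =
      algebraMap A (FractionRing A) (δ c * e - c * δ e) / algebraMap A (FractionRing A) e ^ 2 := by
  have inj := IsFractionRing.injective A (FractionRing A)
  have hb' : algebraMap A (FractionRing A) b ≠ 0 := by simpa using hb
  have he' : algebraMap A (FractionRing A) e ≠ 0 := by simpa using he
  rw [div_eq_div_iff hb' he', ← map_mul, ← map_mul] at h
  have h1 : a * e = c * b := inj h
  have h2 := congrArg δ h1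
  simp only [Derivation.leibniz, smul_eq_mul] at h2
  rw [div_eq_div_iff (pow_ne_zero 2 hb') (pow_ne_zero 2 he'), ← map_pow, ← map_pow, ← map_mul,
    ← map_mul]
  congr 1
  linear_combination (b * e) * h2 - (b * δ e + e * δ b) * h1

/-- The function `a / b ↦ (δ a * b - a * δ b) / b ^ 2` on the field of fractions of `A`, for a
derivation `δ` of the domain `A`. -/
def fractionDerivationFun (δ : Derivation R A A) (f : FractionRing A) : FractionRing A :=
  let a : A := (IsLocalization.sec (nonZeroDivisors A) f).1
  let b : A := (IsLocalization.sec (nonZeroDivisors A) f).2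
  algebraMap A (FractionRing A) (δ a * b - a * δ b) / algebraMap A (FractionRing A) b ^ 2

lemma fractionDerivationFun_div (δ : Derivation R A A) (a : A) {b : A} (hb : b ≠ 0) :
    fractionDerivationFun δ (algebraMap A (FractionRing A) a / algebraMap A (FractionRing A) b) =
      algebraMap A (FractionRing A) (δ a * b - a * δ b) / algebraMap A (FractionRing A) b ^ 2 := by
  set f := algebraMap A (FractionRing A) a / algebraMap A (FractionRing A) b with hf
  have hs : ((IsLocalization.sec (nonZeroDivisors A) f).2 : A) ≠ 0 :=
    nonZeroDivisors.coe_ne_zero _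
  have hs' : algebraMap A (FractionRing A) (IsLocalization.sec (nonZeroDivisors A) f).2 ≠ 0 := by
    simp
  refine quotient_rule_wellDefined δ hs hb ?_
  rw [← hf, div_eq_iff hs']
  exact (IsLocalization.sec_spec (nonZeroDivisors A) f).symm

lemma exists_common_den (f g : FractionRing A) : ∃ a c b : A, b ≠ 0 ∧
    f = algebraMap A (FractionRing A) a / algebraMap A (FractionRing A) b ∧
    g = algebraMap A (FractionRing A) c / algebraMap A (FractionRing A) b := by
  obtain ⟨a, b, hb, rfl⟩ := IsFractionRing.div_surjective A f
  obtain ⟨c, e, he, rfl⟩ := IsFractionRing.div_surjective A g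
  have hb0 := nonZeroDivisors.ne_zero hb
  have he0 := nonZeroDivisors.ne_zero he
  have hb' : algebraMap A (FractionRing A) b ≠ 0 := by simpa using hb0
  have he' : algebraMap A (FractionRing A) e ≠ 0 := by simpa using he0
  refine ⟨a * e, c * b, b * e, mul_ne_zero hb0 he0, ?_, ?_⟩
  · rw [map_mul, map_mul]; field_simp
  · rw [map_mul, map_mul]; field_simp

/-- The unique extension of a derivation of a domain to its field of fractions, given by the
quotient rule. -/
def fractionDerivation (δ : Derivation R A A) :
    Derivation R (FractionRing A) (FractionRing A) :=
  Derivation.mk'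
    { toFun := fractionDerivationFun δ
      map_add' := by
        intro f g
        obtain ⟨a, c, b, hb, rfl, rfl⟩ := exists_common_den f g
        have hb' : algebraMap A (FractionRing A) b ≠ 0 := by simpa using hb
        rw [← add_div, ← map_add, fractionDerivationFun_div _ _ hb, fractionDerivationFun_div _ _ hb,
          fractionDerivationFun_div _ _ hb]
        simp only [map_sub, map_mul, map_add]
        ring
      map_smul' := by
        intro r f
        obtain ⟨a, -, b, hb, rfl, -⟩ := exists_common_den f f
        have hr : ∀ c e : A, r • (algebraMap A (FractionRing A) c / algebraMap A (FractionRing A) e) =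
            algebraMap A (FractionRing A) (r • c) / algebraMap A (FractionRing A) e := by
          intro c e
          rw [Algebra.smul_def, Algebra.smul_def, map_mul,
            ← IsScalarTower.algebraMap_apply R A (FractionRing A), mul_div_assoc]
        rw [RingHom.id_apply, hr, fractionDerivationFun_div _ _ hb, fractionDerivationFun_div _ _ hb,
          ← map_pow, hr, δ.map_smul, smul_sub, smul_mul_assoc, smul_mul_assoc] }
    (by
      intro f g
      obtain ⟨a, c, b, hb, rfl, rfl⟩ := exists_common_den f g
      have hb' : algebraMap A (FractionRing A) b ≠ 0 := by simpa using hb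
      change fractionDerivationFun δ _ =
        _ • fractionDerivationFun δ _ + _ • fractionDerivationFun δ _
      rw [div_mul_div_comm, ← map_mul, ← map_mul, fractionDerivationFun_div _ _ (mul_ne_zero hb hb),
        fractionDerivationFun_div _ _ hb, fractionDerivationFun_div _ _ hb]
      simp only [map_sub, map_mul, map_add, Derivation.leibniz, smul_eq_mul]
      field_simp
      ring)

lemma fractionDerivation_algebraMap (δ : Derivation R A A) (a : A) :
    fractionDerivation δ (algebraMap A (FractionRing A) a) =
      algebraMap A (FractionRing A) (δ a) := by
  have h := fractionDerivationFun_div δ a (one_ne_zero (α := A))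
  simp only [map_one, div_one, one_pow, Derivation.map_one_eq_zero, mul_one, mul_zero,
    sub_zero] at h
  exact h

end Fraction

/-! ### Differential polynomials and differential rational functions -/

/-- The ring `F{x, d}` of differential polynomials over `F` in `x_1, …, x_n`: the variable
`X (i, k)` stands for the derivative `d^k x_i`. -/
abbrev DiffPoly (F : Type*) [Field F] (n : ℕ) : Type _ := MvPolynomial (Fin n × ℕ) F

/-- The field `F⟨x, d⟩` of differential rational functions over `F` in `x_1, …, x_n`. -/
abbrev DiffRat (F : Type*) [Field F] (n : ℕ) : Type _ := FractionRing (DiffPoly F n)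

section Substitution

variable {K F : Type*} [Field K] [Field F] [Algebra K F] {n : ℕ}

/-- Apply a derivation `d` of `F` to all the coefficients of a polynomial over `F`. -/
def coeffDerivationFun (d : Derivation K F F) (P : DiffPoly F n) : DiffPoly F n :=
  ∑ m ∈ P.support, monomial m (d (coeff m P))

lemma coeff_coeffDerivationFun (d : Derivation K F F) (P : DiffPoly F n) (m : Fin n × ℕ →₀ ℕ) :
    coeff m (coeffDerivationFun d P) = d (coeff m P) := by
  classical
  simp only [coeffDerivationFun, coeff_sum, coeff_monomial, Finset.sum_ite_eq', mem_support_iff]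
  split_ifs with h
  · rfl
  · rw [not_not.mp h, map_zero]

/-- The coefficientwise action of a derivation `d` of `F` on polynomials over `F`. -/
def coeffDerivation (d : Derivation K F F) :
    Derivation K (DiffPoly F n) (DiffPoly F n) :=
  Derivation.mk'
    { toFun := coeffDerivationFun d
      map_add' := by
        intro P Q
        ext m
        simp only [coeff_coeffDerivationFun, coeff_add, map_add]
      map_smul' := by
        intro c P
        ext m
        simp only [coeff_coeffDerivationFun, coeff_smul, RingHom.id_apply, Derivation.map_smul] }
    (by
      classical
      intro P Q
      change coeffDerivationFun d (P * Q) =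
        P * coeffDerivationFun d Q + Q * coeffDerivationFun d P
      rw [mul_comm Q]
      ext m
      simp only [coeff_coeffDerivationFun, coeff_add, coeff_mul, map_sum, Derivation.leibniz,
        Finset.sum_add_distrib, smul_eq_mul]
      congr 1
      exact Finset.sum_congr rfl fun _ _ => mul_comm _ _)

lemma coeffDerivation_C (d : Derivation K F F) (a : F) :
    coeffDerivation d (C a : DiffPoly F n) = C (d a) := by
  classical
  change coeffDerivationFun d (C a : DiffPoly F n) = C (d a)
  ext m
  rw [coeff_coeffDerivationFun, coeff_C, coeff_C]
  split_ifs <;> simp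

lemma coeffDerivation_X (d : Derivation K F F) (q : Fin n × ℕ) :
    coeffDerivation d (X q : DiffPoly F n) = 0 := by
  classical
  change coeffDerivationFun d (X q : DiffPoly F n) = 0
  ext m
  rw [coeff_coeffDerivationFun, coeff_X, coeff_zero]
  split_ifs <;> simp

/-- The derivation of `F{x, d}` that extends the derivation `d` of `F` and maps
`d^k x_i` to `d^(k+1) x_i`. -/
def polyDerivation (d : Derivation K F F) (n : ℕ) :
    Derivation K (DiffPoly F n) (DiffPoly F n) :=
  coeffDerivation d +
    (mkDerivation F fun q : Fin n × ℕ =>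
      (X (q.1, q.2 + 1) : DiffPoly F n)).restrictScalars K

lemma polyDerivation_C (d : Derivation K F F) (a : F) :
    polyDerivation d n (C a) = C (d a) := by
  simp [polyDerivation, coeffDerivation_C]

lemma polyDerivation_X (d : Derivation K F F) (q : Fin n × ℕ) :
    polyDerivation d n (X q) = X (q.1, q.2 + 1) := by
  simp [polyDerivation, coeffDerivation_X, mkDerivation_X]

/-- The derivation `d` of the field `F⟨x, d⟩`. -/
def ratDerivation (d : Derivation K F F) (n : ℕ) :
    Derivation K (DiffRat F n) (DiffRat F n) :=
  fractionDerivation (polyDerivation d n)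

/-- The affine group `GL(n, K) ⋉ K^n` of all transformations `v ↦ h v + h₀` of `K^n`; for `T` in it,
`h` is `T.linear` and `h₀` is `T 0`. -/
abbrev AffineGroup (K : Type*) [Field K] (n : ℕ) : Type _ := (Fin n → K) ≃ᵃ[K] (Fin n → K)

/-- The `i`-th coordinate `∑ j, h i j * x_j + h₀ i` of the vector `h x + h₀`. -/
def affineCoord (F : Type*) [Field F] [Algebra K F] (T : AffineGroup K n) (i : Fin n) :
    DiffPoly F n :=
  ∑ j, C (algebraMap K F (T.linear (Pi.single j 1) i)) * X (j, 0) + C (algebraMap K F (T 0 i))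

/-- The derivation `δ = g⁻¹ d` of `F{x, d}`, for `g ∈ F^*`. -/
def scaledDerivation (d : Derivation K F F) (g : Fˣ) (n : ℕ) :
    Derivation K (DiffPoly F n) (DiffPoly F n) :=
  (C (g : F)⁻¹ : DiffPoly F n) • polyDerivation d n

/-- The substitution `P^d{x} ↦ P^(g⁻¹d){h x + h₀}` in differential polynomials: it fixes the
coefficients and replaces `d^k x_i` by `(g⁻¹ d)^k (h x + h₀)_i`. -/
def polySubst (d : Derivation K F F) (g : Fˣ) (T : AffineGroup K n) :
    DiffPoly F n →ₐ[F] DiffPoly F n :=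
  aeval fun q : Fin n × ℕ => (scaledDerivation d g n)^[q.2] (affineCoord F T q.1)

/-! The substitution is injective, so that it extends to differential rational functions. For this,
a left inverse is built from the derivation `Δ` of `F{x, d}` that extends `g⁻¹ d` and maps
`d^k x_i` to `d^(k+1) x_i`. -/

/-- The derivation of `F{x, d}` that extends the derivation `g⁻¹ d` of `F` and maps
`d^k x_i` to `d^(k+1) x_i`. -/
def auxDerivation (d : Derivation K F F) (g : Fˣ) (n : ℕ) :
    Derivation K (DiffPoly F n) (DiffPoly F n) :=
  (C (g : F)⁻¹ : DiffPoly F n) • coeffDerivation d +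
    (mkDerivation F fun q : Fin n × ℕ =>
      (X (q.1, q.2 + 1) : DiffPoly F n)).restrictScalars K

lemma auxDerivation_C (d : Derivation K F F) (g : Fˣ) (a : F) :
    auxDerivation d g n (C a) = C ((g : F)⁻¹ * d a) := by
  simp [auxDerivation, coeffDerivation_C]

lemma auxDerivation_X (d : Derivation K F F) (g : Fˣ) (q : Fin n × ℕ) :
    auxDerivation d g n (X q) = X (q.1, q.2 + 1) := by
  simp [auxDerivation, coeffDerivation_X, mkDerivation_X]

/-- The left inverse of `polySubst d g T`. -/
def polySubstInv (d : Derivation K F F) (g : Fˣ) (T : AffineGroup K n) :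
    DiffPoly F n →ₐ[F] DiffPoly F n :=
  aeval fun q : Fin n × ℕ =>
    ((C (g : F) : DiffPoly F n) • auxDerivation d g n)^[q.2] (affineCoord F T⁻¹ q.1)

lemma polySubstInv_polyDerivation {d : Derivation K F F} (g : Fˣ) (T : AffineGroup K n)
    (P : DiffPoly F n) :
    polySubstInv d g T (polyDerivation d n P) =
      C (g : F) * auxDerivation d g n (polySubstInv d g T P) := by
  induction P using MvPolynomial.induction_on with
  | C a =>
    have h : ∀ b : F, polySubstInv d g T (C b) = C b := fun b => by
      simp [polySubstInv, algebraMap_eq]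
    rw [polyDerivation_C, h, h, auxDerivation_C, ← C_mul, ← mul_assoc,
      mul_inv_cancel₀ g.ne_zero, one_mul]
  | add P Q hP hQ => simp only [map_add, hP, hQ, mul_add]
  | mul_X P q hP =>
    have hX : polySubstInv d g T (X (q.1, q.2 + 1)) =
        C (g : F) * auxDerivation d g n (polySubstInv d g T (X q)) := by
      simp only [polySubstInv, aeval_X, Function.iterate_succ_apply', Derivation.smul_apply,
        smul_eq_mul]
    simp only [Derivation.leibniz, map_add, map_mul, smul_eq_mul, hP, polyDerivation_X, hX]
    ring

lemma polySubstInv_iterate {d : Derivation K F F} (g : Fˣ) (T : AffineGroup K n) (k : ℕ)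
    (P : DiffPoly F n) :
    polySubstInv d g T ((scaledDerivation d g n)^[k] P) =
      (auxDerivation d g n)^[k] (polySubstInv d g T P) := by
  induction k with
  | zero => rfl
  | succ k ih =>
    have h : polySubstInv d g T (C (g : F)⁻¹) = C (g : F)⁻¹ := by
      simp [polySubstInv, algebraMap_eq]
    rw [Function.iterate_succ_apply', Function.iterate_succ_apply', ← ih, scaledDerivation,
      Derivation.smul_apply, smul_eq_mul, map_mul, polySubstInv_polyDerivation, h, ← mul_assoc,
      ← C_mul, inv_mul_cancel₀ g.ne_zero, C_1, one_mul]

lemma auxDerivation_iterate_X (d : Derivation K F F) (g : Fˣ) (i : Fin n) (k : ℕ) :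
    (auxDerivation d g n)^[k] (X (i, 0)) = X (i, k) := by
  induction k with
  | zero => rfl
  | succ k ih => rw [Function.iterate_succ_apply', ih, auxDerivation_X]

lemma linear_apply (T : AffineGroup K n) (v : Fin n → K) (i : Fin n) :
    T.linear v i = ∑ j, T.linear (Pi.single j 1) i * v j := by
  have h2 : T.linear v = ∑ j, v j • T.linear (Pi.single j 1) := by
    conv_lhs => rw [pi_eq_sum_univ' v]
    simp [map_sum]
  rw [h2]
  simp [mul_comm]

lemma polySubstInv_affineCoord (d : Derivation K F F) (g : Fˣ) (T : AffineGroup K n) (i : Fin n) :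
    polySubstInv d g T (affineCoord F T i) = X (i, 0) := by
  classical
  have h0 : ∑ j, T.linear (Pi.single j 1) i * T⁻¹ 0 j + T 0 i = 0 := by
    rw [← linear_apply]
    have h1 : T (T⁻¹ 0) = T.linear (T⁻¹ 0) + T 0 := by
      simpa using T.map_vadd 0 (T⁻¹ 0)
    have h2 : T (T⁻¹ 0) = 0 := T.apply_symm_apply 0
    rw [h2] at h1
    exact (congrFun h1 i).symm
  have hl : ∀ k, ∑ j, T.linear (Pi.single j 1) i * T⁻¹.linear (Pi.single k 1) j =
      if i = k then 1 else 0 := by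
    intro k
    rw [← linear_apply]
    have h1 : T.linear (T⁻¹.linear (Pi.single k 1)) = Pi.single k 1 :=
      T.linear.apply_symm_apply _
    rw [h1, Pi.single_apply]
  have hC : ∀ a : F, polySubstInv d g T (C a) = C a := fun a => by
    simp [polySubstInv, algebraMap_eq]
  have hX : ∀ j, polySubstInv d g T (X (j, 0)) = affineCoord F T⁻¹ j := fun j => by
    simp [polySubstInv]
  rw [affineCoord, map_add, map_sum]
  simp only [map_mul, hC, hX]
  have key : ∀ j, C (algebraMap K F (T.linear (Pi.single j 1) i)) * affineCoord F T⁻¹ j =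
      ∑ k, C (algebraMap K F (T.linear (Pi.single j 1) i * T⁻¹.linear (Pi.single k 1) j)) *
        (X (k, 0) : DiffPoly F n) + C (algebraMap K F (T.linear (Pi.single j 1) i * T⁻¹ 0 j)) := by
    intro j
    rw [affineCoord, mul_add, Finset.mul_sum]
    simp only [map_mul, mul_assoc]
  simp only [key]
  rw [Finset.sum_add_distrib, Finset.sum_comm, add_assoc]
  simp only [← Finset.sum_mul, ← map_sum, ← map_add, hl, h0]
  simp

lemma polySubst_injective {d : Derivation K F F} (g : Fˣ) (T : AffineGroup K n) :
    Function.Injective (polySubst d g T) := by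
  have h : (polySubstInv d g T).comp (polySubst d g T) = AlgHom.id F (DiffPoly F n) := by
    ext1 q
    rw [AlgHom.comp_apply, polySubst, aeval_X, polySubstInv_iterate, polySubstInv_affineCoord,
      auxDerivation_iterate_X, AlgHom.id_apply]
  intro P Q hPQ
  have h1 := congrArg (polySubstInv d g T) hPQ
  rwa [← AlgHom.comp_apply, ← AlgHom.comp_apply, h] at h1

/-- The substitution `f^d⟨x⟩ ↦ f^(g⁻¹d)⟨h x + h₀⟩` in differential rational functions. -/
def ratSubst (d : Derivation K F F) (g : Fˣ) (T : AffineGroup K n) :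
    DiffRat F n →+* DiffRat F n :=
  IsFractionRing.map (K := DiffRat F n) (L := DiffRat F n)
    (j := (polySubst d g T : DiffPoly F n →+* DiffPoly F n)) (polySubst_injective g T)

lemma ratSubst_algebraMap {d : Derivation K F F} (g : Fˣ) (T : AffineGroup K n) (P : DiffPoly F n) :
    ratSubst d g T (algebraMap (DiffPoly F n) (DiffRat F n) P) =
      algebraMap (DiffPoly F n) (DiffRat F n) (polySubst d g T P) := by
  unfold ratSubst IsFractionRing.map
  exact IsLocalization.map_eq _ P

/-- The field `K⟨x, d⟩` of differential rational functions over `K`, as the subfield of `F⟨x, d⟩`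
generated over `K` by all the `d^k x_i`. -/
def constRat (K F : Type*) [Field K] [Field F] [Algebra K F] (n : ℕ) :
    IntermediateField K (DiffRat F n) :=
  IntermediateField.adjoin K
    (Set.range fun q : Fin n × ℕ => algebraMap (DiffPoly F n) (DiffRat F n) (X q))

/-- The field `K⟨x, d⟩^(F^*, H)` of the `f ∈ K⟨x, d⟩` such that
`f^(g⁻¹d)⟨h x + h₀⟩ = f^d⟨x⟩` for all `g ∈ F^*` and all `(h, h₀) ∈ H`. -/
def invariantField (d : Derivation K F F) (H : Subgroup (AffineGroup K n)) :
    IntermediateField K (DiffRat F n) where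
  carrier := {f | f ∈ constRat K F n ∧ ∀ g : Fˣ, ∀ T ∈ H, ratSubst d g T f = f}
  mul_mem' := fun ha hb =>
    ⟨mul_mem ha.1 hb.1, fun g T hT => by rw [map_mul, ha.2 g T hT, hb.2 g T hT]⟩
  add_mem' := fun ha hb =>
    ⟨add_mem ha.1 hb.1, fun g T hT => by rw [map_add, ha.2 g T hT, hb.2 g T hT]⟩
  algebraMap_mem' := fun c => ⟨IntermediateField.algebraMap_mem _ c, fun g T _ => by
    rw [IsScalarTower.algebraMap_apply K (DiffPoly F n) (DiffRat F n), ratSubst_algebraMap,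
      IsScalarTower.algebraMap_apply K F (DiffPoly F n), AlgHom.commutes]⟩
  inv_mem' := fun f hf => ⟨inv_mem hf.1, fun g T hT => by rw [map_inv₀, hf.2 g T hT]⟩

/-- The condition `p^(g⁻¹d)⟨h x + h₀⟩ = g⁻¹ p^d⟨x⟩` for all `g ∈ F^*` and all `(h, h₀) ∈ H`, on a
nonzero `p ∈ K⟨x, d⟩`; it makes the derivation `p⁻¹ d` invariant. -/
structure IsNormalizer (d : Derivation K F F) (H : Subgroup (AffineGroup K n))
    (p : DiffRat F n) : Prop where
  mem : p ∈ constRat K F n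
  ne_zero : p ≠ 0
  subst_eq : ∀ g : Fˣ, ∀ T ∈ H, ratSubst d g T p = algebraMap F (DiffRat F n) (g : F)⁻¹ * p

end Substitution

end

end DiffInvariants

/-! Both bounds compare growth of transcendence degree over K. Up to a bounded error, the
derivatives of order < N of the x_i contribute nN, and those of m differentially independent
elements contribute mN. Passing from d to δ = p⁻¹d costs only a fixed shift in order.

Upper bound. For γ in F^*, the substitution with g = γ⁻¹ and T = 1 fixes every invariant, commutes
with δ on K⟨x, d⟩ and sends p to γp. An algebraic relation over the invariants among the δ^j p
therefore also holds for the jets of all γp. Since d is nonzero, these jets are Zariski dense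
(`eq_zero_of_eval_jet_eq_zero`), so the δ^j p are algebraically independent over the invariants.
With n differentially independent invariants there would then be n + 1 independent families inside a
field of growth n.

Lower bound. As H acts affinely with constant coefficients, the x_j satisfy one linear δ-equation of
order n + 1 whose coefficients a_k are invariant, by Cramer's rule. Every d^m x_j is then algebraic
over finitely many δ^k x_i and the derivatives of p and of the a_k. Here p contributes growth at
most 1, so the a_k must contribute at least n - 1. `exists_diffAlgebraicIndependent_spanning`
extracts from them a differentially independent subset that accounts for all their growth. -/

namespace DiffInvariants

noncomputable section

/-! ### Algebraic dependence as a matroid closure, and derivations -/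

section AlgebraicSpan

open IntermediateField

variable {K E : Type*} [Field K] [Field E] [Algebra K E]

/-- The field of all elements of `E` that are algebraic over `K(X)`. -/
def algSpan (K : Type*) {E : Type*} [Field K] [Field E] [Algebra K E] (X : Set E) :
    IntermediateField K E :=
  (algebraicClosure (adjoin K X) E).restrictScalars K

lemma mem_algSpan {X : Set E} {y : E} : y ∈ algSpan K X ↔ IsAlgebraic (adjoin K X) y := by
  rw [algSpan, IntermediateField.mem_restrictScalars, mem_algebraicClosure_iff]

lemma mem_algSpan_iff_isAlgebraic_adjoin {X : Set E} {y : E} :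
    y ∈ algSpan K X ↔ IsAlgebraic (Algebra.adjoin K X) y := by
  rw [mem_algSpan]
  exact isAlgebraic_adjoin_iff

/-- Bridge to the algebraic-independence matroid: transitivity of dependence and the rank inequality
are taken from there. -/
lemma coe_algSpan (X : Set E) :
    (algSpan K X : Set E) = (AlgebraicIndependent.matroid K E).closure X := by
  rw [AlgebraicIndependent.matroid_closure_eq]
  ext y
  exact mem_algSpan_iff_isAlgebraic_adjoin

lemma subset_algSpan (X : Set E) : X ⊆ algSpan K X := by
  rw [coe_algSpan]
  exact Matroid.subset_closure _ _ (Set.subset_univ _)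

lemma algSpan_le {X Y : Set E} (h : X ⊆ algSpan K Y) : algSpan K X ≤ algSpan K Y := by
  rw [← SetLike.coe_subset_coe, coe_algSpan, coe_algSpan]
  rw [coe_algSpan] at h
  exact Matroid.closure_subset_closure_of_subset_closure h

lemma algSpan_mono {X Y : Set E} (h : X ⊆ Y) : algSpan K X ≤ algSpan K Y :=
  algSpan_le (h.trans (subset_algSpan Y))

/-- Rank in the matroid is monotone and unchanged by closure. Both bounds of the theorem come down
to this count. -/
lemma card_le_of_mem_algSpan {ι κ : Type*} [Fintype ι] [Fintype κ] {v : ι → E} {w : κ → E}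
    (hv : AlgebraicIndependent K v) (h : ∀ i, v i ∈ algSpan K (Set.range w)) :
    Fintype.card ι ≤ Fintype.card κ := by
  classical
  let M := AlgebraicIndependent.matroid K E
  have hI : M.Indep (Set.range v) := hv.to_subtype_range
  have h1 : (Set.range v).encard ≤ (Set.range w).encard := by
    rw [← hI.eRk_eq_encard]
    refine (M.eRk_mono (?_ : _ ⊆ M.closure (Set.range w))).trans ?_
    · rintro _ ⟨i, rfl⟩
      have := h i
      rwa [← SetLike.mem_coe, coe_algSpan] at this
    · rw [M.eRk_closure_eq]
      exact M.eRk_le_encard _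
  have h2 : (Set.range v).encard = Fintype.card ι := by
    rw [← Set.image_univ, hv.injective.encard_image, Set.encard_univ, ENat.card_eq_coe_fintype_card]
  have h3 : (Set.range w).encard ≤ Fintype.card κ := by
    rw [← Set.image_univ, ← ENat.card_eq_coe_fintype_card, ← Set.encard_univ]
    exact Set.encard_image_le _ _
  rw [h2] at h1
  exact_mod_cast h1.trans h3

/-- If a derivation maps generators `X` into `algSpan K Y ⊇ X`, it maps all of `algSpan K X` into
`algSpan K Y`: the derivative of an algebraic element is found by differentiating its minimal
polynomial. -/
lemma derivation_mem_algSpan [CharZero E] (δ : Derivation K E E) {X Y : Set E}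
    (hXY : X ⊆ algSpan K Y) (hδ : ∀ x ∈ X, δ x ∈ algSpan K Y) {y : E} (hy : y ∈ algSpan K X) :
    δ y ∈ algSpan K Y := by
  have hadj : ∀ z ∈ adjoin K X, δ z ∈ algSpan K Y := by
    have hle : adjoin K X ≤ algSpan K Y := adjoin_le_iff.mpr hXY
    intro z hz
    induction hz using adjoin_induction with
    | mem x hx => exact hδ x hx
    | algebraMap c => simp
    | add x y _ _ hx hy => rw [map_add]; exact add_mem hx hy
    | inv x hx h =>
      rw [Derivation.leibniz_inv, smul_eq_mul]
      exact mul_mem (neg_mem (pow_mem (inv_mem (hle hx)) 2)) h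
    | mul x y hx hy h1 h2 =>
      rw [Derivation.leibniz, smul_eq_mul, smul_eq_mul]
      exact add_mem (mul_mem (hle hx) h2) (mul_mem (hle hy) h1)
  have hyY : y ∈ algSpan K Y := algSpan_le hXY hy
  rw [mem_algSpan] at hy
  set P := minpoly (adjoin K X) y with hP
  have hsep : P.Separable := (minpoly.irreducible hy.isIntegral).separable
  have hne : Polynomial.aeval y (Polynomial.derivative P) ≠ 0 :=
    hsep.aeval_derivative_ne_zero (minpoly.aeval _ _)
  have hcoef : ∀ i, (P.coeff i : E) ∈ algSpan K Y := fun i =>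
    (adjoin_le_iff.mpr hXY : adjoin K X ≤ algSpan K Y) (P.coeff i).2
  -- Differentiating Q(y) gives Q'(y) δy plus the value at y of Q with differentiated coefficients.
  -- Only membership of the second term matters. For the minimal polynomial the left side is 0 and
  -- P'(y) ≠ 0 by separability, so δy can be solved for.
  have hder : ∀ Q : Polynomial (adjoin K X),
      δ (Polynomial.aeval y Q) - Polynomial.aeval y (Polynomial.derivative Q) * δ y ∈
        algSpan K Y := by
    intro Q
    induction Q using Polynomial.induction_on' with
    | add p q hp hq =>
      have h := add_mem hp hq
      simp only [map_add, add_mul]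
      convert h using 1
      ring
    | monomial m c =>
      have h : y ^ m * δ (c : E) ∈ algSpan K Y := mul_mem (pow_mem hyY m) (hadj c c.2)
      convert h using 1
      have hc : ∀ e : adjoin K X, algebraMap (adjoin K X) E e = e := fun _ => rfl
      simp only [Polynomial.aeval_monomial, Polynomial.derivative_monomial, hc, Derivation.leibniz,
        Derivation.leibniz_pow, smul_eq_mul, nsmul_eq_mul, MulMemClass.coe_mul]
      push_cast
      ring
  have h := hder P
  rw [minpoly.aeval, map_zero, zero_sub, neg_mem_iff] at h
  have hP' : Polynomial.aeval y (Polynomial.derivative P) ∈ algSpan K Y := by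
    have hle : adjoin K X ≤ algSpan K Y := adjoin_le_iff.mpr hXY
    rw [Polynomial.aeval_eq_sum_range]
    exact sum_mem fun i _ => by
      rw [Algebra.smul_def]
      exact mul_mem (hle (SetLike.coe_mem _)) (pow_mem hyY i)
  rw [← inv_mul_cancel_left₀ hne (δ y)]
  exact mul_mem (inv_mem hP') h

end AlgebraicSpan

/-! ### Differentially independent subsets that carry all the growth -/

section JetBasis

variable {K E : Type*} [Field K] [Field E] [Algebra K E]

/-- The indices `m` such that `v m` is transcendental over the field generated by the earlier terms
of the sequence `v`. -/
def freeIndices (K : Type*) {E : Type*} [Field K] [Field E] [Algebra K E] (v : ℕ → E) : Set ℕ :=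
  {m | v m ∉ algSpan K (v '' Set.Iio m)}

/-- Each free term is transcendental over its predecessors, so independence passes from each initial
segment to the next; independence is of finite character. -/
lemma algebraicIndepOn_freeIndices (v : ℕ → E) :
    AlgebraicIndependent K (fun m : freeIndices K v => v m) := by
  have h : ∀ M, AlgebraicIndepOn K v (freeIndices K v ∩ Set.Iio M) := by
    intro M
    induction M with
    | zero =>
      have : freeIndices K v ∩ Set.Iio 0 = ∅ := by ext; simp
      rw [this]
      exact algebraicIndependent_empty_type
    | succ M ih =>
      by_cases hM : M ∈ freeIndices K v
      · have : freeIndices K v ∩ Set.Iio (M + 1) = insert M (freeIndices K v ∩ Set.Iio M) := by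
          ext m
          simp only [Set.mem_inter_iff, Set.mem_Iio, Set.mem_insert_iff]
          constructor
          · rintro ⟨h1, h2⟩
            rcases Nat.lt_succ_iff_lt_or_eq.mp h2 with h | h
            · exact Or.inr ⟨h1, h⟩
            · exact Or.inl h
          · rintro (rfl | ⟨h1, h2⟩)
            · exact ⟨hM, Nat.lt_succ_self _⟩
            · exact ⟨h1, h2.trans (Nat.lt_succ_self _)⟩
        rw [this]
        refine ih.insert fun halg => hM ?_
        exact algSpan_mono (Set.image_mono Set.inter_subset_right)
          (mem_algSpan_iff_isAlgebraic_adjoin.mpr halg)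
      · have : freeIndices K v ∩ Set.Iio (M + 1) = freeIndices K v ∩ Set.Iio M := by
          ext m
          simp only [Set.mem_inter_iff, Set.mem_Iio]
          refine and_congr_right fun h1 => ⟨fun h2 => ?_, fun h2 => h2.trans (Nat.lt_succ_self _)⟩
          rcases Nat.lt_succ_iff_lt_or_eq.mp h2 with h | rfl
          · exact h
          · exact absurd h1 hM
        rwa [this]
  refine algebraicIndependent_of_finite_type fun t ht => ?_
  obtain ⟨M, hM⟩ := (ht.image Subtype.val).bddAbove
  let f : t → ↥(freeIndices K v ∩ Set.Iio (M + 1)) := fun m =>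
    ⟨m.1, m.1.2, Nat.lt_succ_of_le (hM ⟨m.1, m.2, rfl⟩)⟩
  refine (h (M + 1)).comp f fun m m' hmm => ?_
  have h1 : (f m : ℕ) = f m' := congrArg Subtype.val hmm
  exact Subtype.ext (Subtype.ext h1)

/-- A term that is not free depends on earlier ones, so strong induction applies. The cutoff at m is
what later keeps the orders of derivatives under control. -/
lemma mem_algSpan_freeIndices (v : ℕ → E) (m : ℕ) :
    v m ∈ algSpan K (v '' (freeIndices K v ∩ Set.Iic m)) := by
  induction m using Nat.strong_induction_on with
  | _ m ih =>
    by_cases hm : m ∈ freeIndices K v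
    · exact subset_algSpan _ ⟨m, ⟨hm, le_refl m⟩, rfl⟩
    · refine algSpan_le ?_ (not_not.mp hm)
      rintro _ ⟨k, hk, rfl⟩
      refine algSpan_mono (Set.image_mono ?_) (ih k hk)
      exact Set.inter_subset_inter_right _ (Set.Iic_subset_Iic.mpr (le_of_lt hk))

/-- Contrapositive: differentiating a dependence of `v m` on earlier terms gives a dependence of `v
(m + n)` on terms of index below m + n. -/
lemma freeIndices_of_add [CharZero E] {δ : Derivation K E E} {v : ℕ → E} {n : ℕ}
    (hv : ∀ m, δ (v m) = v (m + n)) {m : ℕ} (hm : m + n ∈ freeIndices K v) :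
    m ∈ freeIndices K v := by
  by_contra h
  refine hm ?_
  rw [← hv]
  rcases Nat.eq_zero_or_pos n with rfl | hn
  · rw [hv]; exact not_not.mp h
  refine derivation_mem_algSpan δ ?_ ?_ (not_not.mp h)
  · rintro _ ⟨k, hk, rfl⟩
    exact subset_algSpan _ ⟨k, lt_of_lt_of_le hk (Nat.le_add_right _ _), rfl⟩
  · rintro _ ⟨k, hk, rfl⟩
    rw [hv]
    exact subset_algSpan _ ⟨k + n, Nat.add_lt_add_right hk n, rfl⟩

/-- Among finitely many elements, some are differentially algebraically independent and, up to
finitely many elements, determine all derivatives algebraically, order by order. -/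
theorem exists_diffAlgebraicIndependent_spanning [CharZero E] (δ : Derivation K E E) {n : ℕ}
    (a : Fin n → E) :
    ∃ (S : Finset (Fin n)) (R : ℕ), DiffAlgebraicIndependent δ (fun i : S => a i) ∧
      ∀ N, ∀ m ≤ N, ∀ i, δ^[m] (a i) ∈ algSpan K
        (Set.range (fun q : S × Fin (N + 1) => δ^[q.2] (a q.1)) ∪
          Set.range (fun q : Fin n × Fin R => δ^[q.2] (a q.1))) := by
  classical
  rcases Nat.eq_zero_or_pos n with rfl | hn
  · refine ⟨∅, 0, ?_, fun N m _ i => i.elim0⟩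
    exact algebraicIndependent_empty_type
  -- All jets listed order by order, so that δ shifts the index by n and the residue mod n records
  -- which a_i is differentiated.
  let v : ℕ → E := fun m => δ^[m / n] (a ⟨m % n, Nat.mod_lt m hn⟩)
  have hv : ∀ m, δ (v m) = v (m + n) := fun m => by
    simp only [v, Nat.add_div_right m hn, Nat.add_mod_right, Function.iterate_succ_apply']
  have hvk : ∀ k (i : Fin n), v (k * n + i) = δ^[k] (a i) := fun k i => by
    have h1 : (k * n + i) / n = k := by
      rw [mul_comm, Nat.mul_add_div hn, Nat.div_eq_of_lt i.2, add_zero]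
    have h2 : (k * n + i) % n = i := by
      rw [mul_comm, Nat.mul_add_mod, Nat.mod_eq_of_lt i.2]
    simp only [v, h1, h2]
  -- The residue classes that are free throughout. In any other class freeness stops at some order
  -- and, by the shift property, never resumes.
  let S : Finset (Fin n) := {i | ∀ k, k * n + i ∈ freeIndices K v}
  have hS : ∀ i : Fin n, ∃ r, i ∉ S → r * n + i ∉ freeIndices K v := fun i => by
    by_cases h : i ∈ S
    · exact ⟨0, fun h' => absurd h h'⟩
    · have : ¬ ∀ k, k * n + i ∈ freeIndices K v := by simpa [S] using h
      obtain ⟨r, hr⟩ := not_forall.mp this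
      exact ⟨r, fun _ => hr⟩
  choose r hr using hS
  have hlt : ∀ i ∉ S, ∀ k, k * n + i ∈ freeIndices K v → k < r i := by
    intro i hi k hk
    by_contra hkr
    obtain ⟨c, rfl⟩ := Nat.exists_eq_add_of_le (not_lt.mp hkr)
    refine hr i hi ?_
    clear hkr
    induction c with
    | zero => exact hk
    | succ c ih =>
      refine ih (freeIndices_of_add hv (n := n) ?_)
      convert hk using 1
      ring
  refine ⟨S, ∑ i, r i, ?_, ?_⟩
  · let f : S × ℕ → freeIndices K v := fun q => ⟨q.2 * n + q.1, by
      have := q.1.2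
      simp only [S, Finset.mem_filter, Finset.mem_univ, true_and] at this
      exact this q.2⟩
    have hf : Function.Injective f := by
      rintro ⟨i, k⟩ ⟨i', k'⟩ h
      have h1 : k * n + i.1.1 = k' * n + i'.1.1 := congrArg Subtype.val h
      have h2 : k = k' := by
        have := congrArg (· / n) h1
        simpa only [mul_comm _ n, Nat.mul_add_div hn, Nat.div_eq_of_lt (Fin.is_lt _), add_zero]
          using this
      subst h2
      have h3 : i = i' := Subtype.ext (Fin.ext (Nat.add_left_cancel h1))
      rw [h3]
    have h := (algebraicIndepOn_freeIndices (K := K) v).comp f hf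
    have heq : (fun q : S × ℕ => δ^[q.2] (a q.1)) = (fun m : freeIndices K v => v m) ∘ f := by
      funext q
      exact (hvk q.2 q.1).symm
    rw [DiffAlgebraicIndependent, heq]
    exact h
  · intro N m hm i
    rw [← hvk]
    refine algSpan_mono ?_ (mem_algSpan_freeIndices v _)
    rintro _ ⟨l, ⟨hl, hl'⟩, rfl⟩
    have hl2 : l = l / n * n + (⟨l % n, Nat.mod_lt l hn⟩ : Fin n) := (Nat.div_add_mod' l n).symm
    rw [hl2] at hl ⊢
    rw [hvk]
    set i' : Fin n := ⟨l % n, Nat.mod_lt l hn⟩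
    -- A free index l ≤ mn + i has order at most m, so no derivative of order above N is used.
    have hlm : l / n ≤ m := by
      have h : l / n ≤ (m * n + i) / n := Nat.div_le_div_right hl'
      rwa [mul_comm, Nat.mul_add_div hn, Nat.div_eq_of_lt i.2, add_zero] at h
    by_cases hi : i' ∈ S
    · exact Or.inl ⟨(⟨i', hi⟩, ⟨l / n, by omega⟩), rfl⟩
    · refine Or.inr ⟨(i', ⟨l / n, (hlt i' hi _ hl).trans_le ?_⟩), rfl⟩
      exact Finset.single_le_sum (fun _ _ => Nat.zero_le _) (Finset.mem_univ i')

end JetBasis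

/-! ### Zariski density of the jets of multiples of y -/

section NonconstantParameter

variable {K E : Type*} [Field K] [Field E] [Algebra K E]

/-- The value at `y` of the `k`-fold commutator of the operator `δ^j` with multiplication by `t`. -/
def iterCommutator (δ : Derivation K E E) (t : E) (j : ℕ) : ℕ → E → E
  | 0, y => δ^[j] y
  | k + 1, y => iterCommutator δ t j k (t * y) - t * iterCommutator δ t j k y

lemma iterCommutator_add (δ : Derivation K E E) (t : E) (j k : ℕ) (y z : E) :
    iterCommutator δ t j k (y + z) = iterCommutator δ t j k y + iterCommutator δ t j k z := by
  induction k generalizing y z with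
  | zero => exact iterate_map_add δ j y z
  | succ k ih => simp only [iterCommutator, mul_add, ih]; ring

lemma iterCommutator_zero_succ (δ : Derivation K E E) (t : E) (k : ℕ) (y : E) :
    iterCommutator δ t 0 (k + 1) y = 0 := by
  induction k generalizing y with
  | zero => simp [iterCommutator]
  | succ k ih => rw [iterCommutator, ih, ih]; simp

/-- Leibniz rule for commutation with t applied to δ^j ∘ δ: the commutator of δ with t is
multiplication by δt, which commutes with t. -/
lemma iterCommutator_succ_succ (δ : Derivation K E E) (t : E) (j k : ℕ) (y : E) :
    iterCommutator δ t (j + 1) (k + 1) y =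
      iterCommutator δ t j (k + 1) (δ y) + (k + 1) * iterCommutator δ t j k (δ t * y) := by
  induction k generalizing y with
  | zero =>
    simp only [iterCommutator, Function.iterate_succ_apply, Derivation.leibniz, smul_eq_mul]
    rw [iterate_map_add, mul_comm y]
    push_cast
    ring
  | succ k ih =>
    rw [iterCommutator, ih, ih, Derivation.leibniz, smul_eq_mul, smul_eq_mul, mul_comm y,
      iterCommutator_add]
    have h1 : iterCommutator δ t j (k + 1 + 1) (δ y) = iterCommutator δ t j (k + 1) (t * δ y) -
        t * iterCommutator δ t j (k + 1) (δ y) := rfl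
    have h2 : iterCommutator δ t j (k + 1) (δ t * y) = iterCommutator δ t j k (t * (δ t * y)) -
        t * iterCommutator δ t j k (δ t * y) := rfl
    rw [h1, h2, show δ t * (t * y) = t * (δ t * y) by ring]
    push_cast
    ring

/-- Each commutator with a function lowers the order of a differential operator by one. -/
lemma iterCommutator_eq_zero (δ : Derivation K E E) (t : E) {j k : ℕ} (h : j < k) (y : E) :
    iterCommutator δ t j k y = 0 := by
  induction j generalizing k y with
  | zero =>
    obtain ⟨k, rfl⟩ := Nat.exists_eq_succ_of_ne_zero h.ne'
    exact iterCommutator_zero_succ δ t k y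
  | succ j ih =>
    obtain ⟨k, rfl⟩ := Nat.exists_eq_succ_of_ne_zero (Nat.ne_zero_of_lt h)
    rw [iterCommutator_succ_succ, ih (by omega), ih (by omega)]
    simp

lemma iterCommutator_self (δ : Derivation K E E) (t : E) (j : ℕ) (y : E) :
    iterCommutator δ t j j y = (Nat.factorial j : E) * ((δ t) ^ j * y) := by
  induction j generalizing y with
  | zero => simp [iterCommutator]
  | succ j ih =>
    rw [iterCommutator_succ_succ, iterCommutator_eq_zero δ t (Nat.lt_succ_self j), ih,
      Nat.factorial_succ]
    push_cast
    ring

/-- A differential operator `∑ j < r, b j δ^j` that vanishes at `y, t y, …, t^(r-1) y` is zero, if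
`y ≠ 0` and `t` is not a constant. -/
lemma eq_zero_of_sum_mul_iterate_eq_zero [CharZero E] (δ : Derivation K E E) {t y : E}
    (ht : δ t ≠ 0) (hy : y ≠ 0) {r : ℕ} (b : Fin r → E)
    (h : ∀ k < r, ∑ j : Fin r, b j * δ^[j] (t ^ k * y) = 0) : b = 0 := by
  -- A k-fold commutator evaluated at t^l y only involves values of the operator at t^l y, …,
  -- t^(l+k) y, all known to vanish.
  have hcomm : ∀ k l, k + l < r → ∑ j : Fin r, b j * iterCommutator δ t j k (t ^ l * y) = 0 := by
    intro k
    induction k with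
    | zero => intro l hl; exact h l (by omega)
    | succ k ih =>
      intro l hl
      have h1 := ih (l + 1) (by omega)
      have h2 := ih l (by omega)
      have : ∀ j : Fin r, b j * iterCommutator δ t j (k + 1) (t ^ l * y) =
          b j * iterCommutator δ t j k (t ^ (l + 1) * y) -
            t * (b j * iterCommutator δ t j k (t ^ l * y)) := fun j => by
        rw [iterCommutator, ← mul_assoc t, ← pow_succ']
        ring
      rw [Finset.sum_congr rfl fun j _ => this j, Finset.sum_sub_distrib, ← Finset.mul_sum, h1, h2]
      simp
  -- Descent from the top coefficient, with c its distance from k. The k-fold commutator kills the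
  -- orders below k, the coefficients above k already vanish, and order k leaves b_k times k! (δt)^k
  -- y.
  have key : ∀ c, ∀ k : Fin r, r = k + 1 + c → b k = 0 := by
    intro c
    induction c using Nat.strong_induction_on with
    | _ c ih =>
      intro k hk
      have hsum := hcomm k 0 (by simp)
      rw [Finset.sum_eq_single k] at hsum
      · rw [iterCommutator_self] at hsum
        have hne : (Nat.factorial k : E) * ((δ t) ^ (k : ℕ) * (t ^ 0 * y)) ≠ 0 := by
          refine mul_ne_zero (Nat.cast_ne_zero.mpr (Nat.factorial_ne_zero _))
            (mul_ne_zero (pow_ne_zero _ ht) ?_)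
          simpa using hy
        exact (mul_eq_zero.mp hsum).resolve_right hne
      · intro j _ hjk
        rcases lt_or_gt_of_ne (fun h => hjk (Fin.ext h) : (j : ℕ) ≠ k) with hlt | hlt
        · rw [iterCommutator_eq_zero δ t hlt, mul_zero]
        · rw [ih (r - (j + 1)) (by omega) j (by omega), zero_mul]
      · simp
  funext k
  exact key (r - (k + 1)) k (by omega)

/-- A polynomial over `E` that vanishes at the jets `(δ^j (γ y))_j` for all nonzero `γ = ∑ c_k t^k`
with constant coefficients `c_k` is zero. -/
theorem eq_zero_of_eval_jet_eq_zero [CharZero E] [Infinite K] (δ : Derivation K E E) {t y : E}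
    (ht : δ t ≠ 0) (hy : y ≠ 0) {r : ℕ} (hr : 0 < r) (Q : MvPolynomial (Fin r) E)
    (hQ : ∀ c : Fin r → K, ∑ k, c k • t ^ (k : ℕ) ≠ 0 →
      MvPolynomial.eval (fun j : Fin r => δ^[j] ((∑ k, c k • t ^ (k : ℕ)) * y)) Q = 0) : Q = 0 := by
  -- The columns are the jets of t^k y. A row vector in the left kernel is a differential operator
  -- vanishing at y, ty, …, t^(r-1) y, hence zero.
  let A : Matrix (Fin r) (Fin r) E := fun j k => δ^[j] (t ^ (k : ℕ) * y)
  have hA : IsUnit A := by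
    rw [← Matrix.vecMul_injective_iff_isUnit]
    refine (injective_iff_map_eq_zero (Matrix.vecMulLinear A)).mpr fun b hb => ?_
    refine eq_zero_of_sum_mul_iterate_eq_zero δ ht hy b fun k hk => ?_
    exact congrFun hb ⟨k, hk⟩
  let Q' : MvPolynomial (Fin r) E :=
    MvPolynomial.aeval (fun j => ∑ k, MvPolynomial.C (A j k) * MvPolynomial.X k) Q
  have hQ' : ∀ c : Fin r → E, MvPolynomial.eval c Q' = MvPolynomial.eval (A.mulVec c) Q := by
    intro c
    have h : (fun j => MvPolynomial.eval c
        (∑ k, MvPolynomial.C (A j k) * MvPolynomial.X k)) = A.mulVec c := by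
      funext j
      simp [Matrix.mulVec, dotProduct]
    rw [← h]
    rw [show Q' = MvPolynomial.bind₁ _ Q from rfl, MvPolynomial.eval, MvPolynomial.eval₂Hom_bind₁]
    rfl
  let Γ : MvPolynomial (Fin r) E :=
    ∑ k : Fin r, MvPolynomial.C (t ^ (k : ℕ)) * MvPolynomial.X k
  have hΓ : ∀ c : Fin r → E, MvPolynomial.eval c Γ = ∑ k, c k * t ^ (k : ℕ) := fun c => by
    simp [Γ, mul_comm]
  -- The hypothesis says nothing where γ = 0. Multiplying by Γ, which is γ as a polynomial in the
  -- c_k, makes the product vanish at every K-point; K is infinite.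
  have hprod : Q' * Γ = 0 := by
    refine MvPolynomial.funext_set (fun _ => Set.range (algebraMap K E))
      (fun _ => Set.infinite_range_of_injective (algebraMap K E).injective) fun c hc => ?_
    choose c' hc' using fun i => hc i (Set.mem_univ i)
    obtain rfl : (fun i => algebraMap K E (c' i)) = c := funext hc'
    rw [map_mul, map_zero, hQ', hΓ]
    by_cases h0 : ∑ k, algebraMap K E (c' k) * t ^ (k : ℕ) = 0
    · rw [h0, mul_zero]
    · simp only [← Algebra.smul_def] at h0
      have h : A.mulVec (fun k => algebraMap K E (c' k)) =
          fun j : Fin r => δ^[j] ((∑ k, c' k • t ^ (k : ℕ)) * y) := by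
        funext j
        have hpow : ∀ z : E, δ^[j] z = ((δ : E →ₗ[K] E) ^ (j : ℕ)) z := fun z =>
          (Module.End.pow_apply _ _ _).symm
        simp only [Matrix.mulVec, dotProduct, A, hpow, Finset.sum_mul, smul_mul_assoc, map_sum,
          map_smul]
        exact Finset.sum_congr rfl fun k _ => by rw [Algebra.smul_def, mul_comm]
      rw [h, hQ c' h0, zero_mul]
  rcases mul_eq_zero.mp hprod with h0 | h0
  · refine MvPolynomial.funext fun e => ?_
    obtain ⟨c, rfl⟩ := Matrix.mulVec_surjective_iff_isUnit.mpr hA e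
    rw [← hQ', h0]
    simp
  · have h1 := hΓ (Pi.single ⟨0, hr⟩ 1)
    rw [h0] at h1
    simp [Pi.single_apply] at h1

end NonconstantParameter

open MvPolynomial

/-! ### Restriction to a subfield and bounds on the differential transcendence degree -/

section Restriction

variable {K E : Type*} [Field K] [Field E] [Algebra K E]

lemma restrictDerivation_iterate (δ : Derivation K E E) (L : IntermediateField K E)
    (hL : ∀ f ∈ L, δ f ∈ L) (k : ℕ) (f : L) :
    (((restrictDerivation δ L hL)^[k] f : L) : E) = δ^[k] (f : E) := by
  induction k with
  | zero => rfl
  | succ k ih =>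
    rw [Function.iterate_succ_apply', Function.iterate_succ_apply', ← ih]
    rfl

lemma diffAlgebraicIndependent_restrictDerivation (δ : Derivation K E E)
    (L : IntermediateField K E) (hL : ∀ f ∈ L, δ f ∈ L) {ι : Type*} (f : ι → L) :
    DiffAlgebraicIndependent (restrictDerivation δ L hL) f ↔
      DiffAlgebraicIndependent δ (fun i => (f i : E)) := by
  have h := L.val.algebraicIndependent_iff (x := fun q : ι × ℕ =>
    (restrictDerivation δ L hL)^[q.2] (f q.1)) L.val.injective
  rw [DiffAlgebraicIndependent, DiffAlgebraicIndependent, ← h]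
  have heq : (L.val ∘ fun q : ι × ℕ => (restrictDerivation δ L hL)^[q.2] (f q.1)) =
      fun q : ι × ℕ => δ^[q.2] (f q.1 : E) :=
    funext fun q => restrictDerivation_iterate δ L hL q.2 (f q.1)
  rw [heq]

lemma derivation_iterate_smul (δ : Derivation K E E) (k : ℕ) (c : K) (y : E) :
    δ^[k] (c • y) = c • δ^[k] y := by
  induction k with
  | zero => rfl
  | succ k ih => simp only [Function.iterate_succ_apply', ih, Derivation.map_smul]

lemma derivation_iterate_sum (δ : Derivation K E E) (k : ℕ) {ι : Type*} (s : Finset ι)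
    (f : ι → E) : δ^[k] (∑ i ∈ s, f i) = ∑ i ∈ s, δ^[k] (f i) := by
  induction k with
  | zero => rfl
  | succ k ih => simp only [Function.iterate_succ_apply', ih, map_sum]

lemma diffTrdeg_le {δ : Derivation K E E} {m : ℕ}
    (h : ∀ f : Fin (m + 1) → E, ¬ DiffAlgebraicIndependent δ f) : diffTrdeg δ ≤ m := by
  refine ciSup_le' fun s => ?_
  by_contra hs
  have h1 : ((m + 1 : ℕ) : Cardinal) ≤ Cardinal.mk s.1 := by
    rw [Nat.cast_add_one, ← Cardinal.succ_natCast]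
    exact Order.succ_le_of_lt (not_le.mp hs)
  have h2 : Cardinal.lift (Cardinal.mk (Fin (m + 1))) ≤ Cardinal.lift.{0} (Cardinal.mk s.1) := by
    simpa using h1
  obtain ⟨e⟩ := Cardinal.lift_mk_le'.mp h2
  refine h (fun i => e i) ?_
  exact AlgebraicIndependent.comp s.2 (Prod.map e id) (e.injective.prodMap Function.injective_id)

lemma le_diffTrdeg {δ : Derivation K E E} {ι : Type*} [Fintype ι] {f : ι → E}
    (hf : DiffAlgebraicIndependent δ f) : (Fintype.card ι : Cardinal) ≤ diffTrdeg δ := by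
  have hinj : Function.Injective f := fun i j hij =>
    congrArg Prod.fst (AlgebraicIndependent.injective hf (a₁ := (i, 0)) (a₂ := (j, 0)) hij)
  let e := Equiv.ofInjective f hinj
  have hr : DiffAlgebraicIndependent δ (fun a : Set.range f => (a : E)) := by
    have h := AlgebraicIndependent.comp hf (Prod.map e.symm id)
      (e.symm.injective.prodMap Function.injective_id)
    have heq : ∀ a : Set.range f, f (e.symm a) = a := fun a =>
      congrArg Subtype.val (e.apply_symm_apply a)
    rw [DiffAlgebraicIndependent]
    simpa only [Function.comp_def, Prod.map_fst, Prod.map_snd, id, heq] using h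
  -- The family of cardinals must be bounded for its supremum to be meaningful; it is, being indexed
  -- by a small type.
  refine le_trans ?_ (le_ciSup (f := fun s : {s : Set E // DiffAlgebraicIndependent δ
    (fun a : s => (a : E))} => Cardinal.mk s.1) (Cardinal.bddAbove_of_small) ⟨Set.range f, hr⟩)
  have h := Cardinal.mk_range_eq_of_injective hinj
  rw [Cardinal.mk_fintype ι, Cardinal.lift_natCast, Cardinal.lift_eq_nat_iff] at h
  exact h.ge

end Restriction

/-! ### The substitution action and its commutation with δ -/

section Substitution

variable {K F : Type*} [Field K] [Field F] [Algebra K F] {n : ℕ}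

/-- The derivative `d^k x_i` in `F⟨x, d⟩`. -/
def ratX (F : Type*) [Field F] {n : ℕ} (i : Fin n) (k : ℕ) : DiffRat F n :=
  algebraMap (DiffPoly F n) (DiffRat F n) (X (i, k))

lemma charZero_diffRat [CharZero F] : CharZero (DiffRat F n) :=
  charZero_of_injective_algebraMap (algebraMap F (DiffRat F n)).injective

lemma ratDerivation_ratX (d : Derivation K F F) (i : Fin n) (k : ℕ) :
    ratDerivation d n (ratX F i k) = ratX F i (k + 1) := by
  rw [ratX, ratDerivation, fractionDerivation_algebraMap, polyDerivation_X, ratX]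

lemma ratDerivation_iterate_ratX (d : Derivation K F F) (i : Fin n) (k : ℕ) :
    (ratDerivation d n)^[k] (ratX F i 0) = ratX F i k := by
  induction k with
  | zero => rfl
  | succ k ih => rw [Function.iterate_succ_apply', ih, ratDerivation_ratX]

lemma algebraMap_eq_algebraMap_C (a : F) :
    algebraMap F (DiffRat F n) a = algebraMap (DiffPoly F n) (DiffRat F n) (C a) := by
  rw [IsScalarTower.algebraMap_apply F (DiffPoly F n) (DiffRat F n)]
  rfl

lemma ratDerivation_algebraMap (d : Derivation K F F) (a : F) :
    ratDerivation d n (algebraMap F (DiffRat F n) a) = algebraMap F (DiffRat F n) (d a) := by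
  rw [algebraMap_eq_algebraMap_C, ratDerivation, fractionDerivation_algebraMap, polyDerivation_C,
    algebraMap_eq_algebraMap_C]

lemma ratSubst_algebraMap_field {d : Derivation K F F} (g : Fˣ) (T : AffineGroup K n) (a : F) :
    ratSubst d g T (algebraMap F (DiffRat F n) a) = algebraMap F (DiffRat F n) a := by
  rw [algebraMap_eq_algebraMap_C, ratSubst_algebraMap]
  congr 1
  exact (polySubst d g T).commutes a

lemma ratSubst_algebraMap_const {d : Derivation K F F} (g : Fˣ) (T : AffineGroup K n) (c : K) :
    ratSubst d g T (algebraMap K (DiffRat F n) c) = algebraMap K (DiffRat F n) c := by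
  rw [IsScalarTower.algebraMap_apply K F (DiffRat F n), ratSubst_algebraMap_field]

lemma algebraicIndependent_ratX :
    AlgebraicIndependent K (fun q : Fin n × ℕ => ratX F q.1 q.2) := by
  have h := (MvPolynomial.algebraicIndependent_X (Fin n × ℕ) F).restrictScalars
    (algebraMap K F).injective
  exact h.map' (f := IsScalarTower.toAlgHom K (DiffPoly F n) (DiffRat F n))
    (IsFractionRing.injective (DiffPoly F n) (DiffRat F n))

lemma ratX_mem_constRat (i : Fin n) (k : ℕ) : ratX F i k ∈ constRat K F n :=
  IntermediateField.subset_adjoin _ _ ⟨(i, k), rfl⟩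

lemma ratSubst_ratDerivation_ratX (d : Derivation K F F) (g : Fˣ) (T : AffineGroup K n)
    (i : Fin n) (k : ℕ) :
    ratSubst d g T (ratX F i (k + 1)) =
      algebraMap F (DiffRat F n) (g : F)⁻¹ * ratDerivation d n (ratSubst d g T (ratX F i k)) := by
  rw [ratX, ratX, ratSubst_algebraMap, ratSubst_algebraMap, ratDerivation,
    fractionDerivation_algebraMap, algebraMap_eq_algebraMap_C, ← map_mul]
  congr 1
  simp only [polySubst, aeval_X, Function.iterate_succ_apply']
  rfl

lemma ratDerivation_mem_constRat (d : Derivation K F F) {y : DiffRat F n}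
    (hy : y ∈ constRat K F n) : ratDerivation d n y ∈ constRat K F n := by
  rw [constRat] at hy
  induction hy using IntermediateField.adjoin_induction with
  | mem x hx =>
    obtain ⟨⟨i, k⟩, rfl⟩ := hx
    change ratDerivation d n (ratX F i k) ∈ _
    rw [ratDerivation_ratX]
    exact ratX_mem_constRat i (k + 1)
  | algebraMap c => simp
  | add x y _ _ hx hy => rw [map_add]; exact add_mem hx hy
  | inv x hx h =>
    rw [Derivation.leibniz_inv, smul_eq_mul]
    exact mul_mem (neg_mem (pow_mem (inv_mem hx) 2)) h
  | mul x y hx hy h1 h2 =>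
    rw [Derivation.leibniz, smul_eq_mul, smul_eq_mul]
    exact add_mem (mul_mem hx h2) (mul_mem hy h1)

/-- True on the generators by construction, and stable under field operations. Restriction to K⟨x,
d⟩ is essential: the substitution fixes F, so a in F with da ≠ 0 violates the identity unless g = 1.
-/
lemma ratSubst_ratDerivation (d : Derivation K F F) (g : Fˣ) (T : AffineGroup K n)
    {y : DiffRat F n} (hy : y ∈ constRat K F n) :
    ratSubst d g T (ratDerivation d n y) =
      algebraMap F (DiffRat F n) (g : F)⁻¹ * ratDerivation d n (ratSubst d g T y) := by
  rw [constRat] at hy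
  induction hy using IntermediateField.adjoin_induction with
  | mem x hx =>
    obtain ⟨⟨i, k⟩, rfl⟩ := hx
    change ratSubst d g T (ratDerivation d n (ratX F i k)) = _
    rw [ratDerivation_ratX]
    exact ratSubst_ratDerivation_ratX d g T i k
  | algebraMap c => simp [ratSubst_algebraMap_const]
  | add x y _ _ hx hy => simp only [map_add, hx, hy, mul_add]
  | inv x hx h =>
    simp only [Derivation.leibniz_inv, smul_eq_mul, map_mul, map_neg, map_pow, map_inv₀, h]
    ring
  | mul x y hx hy h1 h2 =>
    simp only [Derivation.leibniz, smul_eq_mul, map_mul, map_add, h1, h2]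
    ring

variable {d : Derivation K F F} {H : Subgroup (AffineGroup K n)} {p : DiffRat F n}

lemma smul_ratDerivation_mem_constRat (hp : p ∈ constRat K F n) {y : DiffRat F n}
    (hy : y ∈ constRat K F n) : (p⁻¹ • ratDerivation d n) y ∈ constRat K F n := by
  rw [Derivation.smul_apply, smul_eq_mul]
  exact mul_mem (inv_mem hp) (ratDerivation_mem_constRat d hy)

lemma smul_ratDerivation_iterate_mem_constRat (hp : p ∈ constRat K F n) {y : DiffRat F n}
    (hy : y ∈ constRat K F n) (k : ℕ) : (p⁻¹ • ratDerivation d n)^[k] y ∈ constRat K F n := by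
  induction k with
  | zero => exact hy
  | succ k ih =>
    rw [Function.iterate_succ_apply']
    exact smul_ratDerivation_mem_constRat hp ih

/-- The factor g⁻¹ acquired by d cancels the one acquired by p. -/
lemma IsNormalizer.ratSubst_smul_ratDerivation (hp : IsNormalizer d H p) (g : Fˣ)
    {T : AffineGroup K n} (hT : T ∈ H) {y : DiffRat F n} (hy : y ∈ constRat K F n) :
    ratSubst d g T ((p⁻¹ • ratDerivation d n) y) =
      (p⁻¹ • ratDerivation d n) (ratSubst d g T y) := by
  have hg : algebraMap F (DiffRat F n) (g : F)⁻¹ ≠ 0 := by simp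
  have := hp.ne_zero
  simp only [Derivation.smul_apply, smul_eq_mul, map_mul, map_inv₀ (ratSubst d g T),
    hp.subst_eq g T hT, ratSubst_ratDerivation d g T hy]
  field_simp

lemma IsNormalizer.ratSubst_iterate (hp : IsNormalizer d H p) (g : Fˣ)
    {T : AffineGroup K n} (hT : T ∈ H) {y : DiffRat F n} (hy : y ∈ constRat K F n) (k : ℕ) :
    ratSubst d g T ((p⁻¹ • ratDerivation d n)^[k] y) =
      (p⁻¹ • ratDerivation d n)^[k] (ratSubst d g T y) := by
  induction k with
  | zero => rfl
  | succ k ih =>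
    rw [Function.iterate_succ_apply', Function.iterate_succ_apply', ← ih,
      hp.ratSubst_smul_ratDerivation g hT
        (smul_ratDerivation_iterate_mem_constRat hp.mem hy k)]

lemma IsNormalizer.smul_ratDerivation_mem_invariantField (hp : IsNormalizer d H p)
    {f : DiffRat F n} (hf : f ∈ invariantField d H) :
    (p⁻¹ • ratDerivation d n) f ∈ invariantField d H :=
  ⟨smul_ratDerivation_mem_constRat hp.mem hf.1, fun g T hT => by
    rw [hp.ratSubst_smul_ratDerivation g hT hf.1, hf.2 g T hT]⟩

/-! ### The upper bound -/

/-- The derivatives of `p` are algebraically independent over the field of invariants, as `p` can be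
scaled by all elements of `F^*` without changing the invariants. -/
theorem IsNormalizer.algebraicIndependent_iterate [CharZero F] (hp : IsNormalizer d H p)
    (hd : ∃ a : F, d a ≠ 0) :
    AlgebraicIndependent (invariantField d H)
      (fun k : ℕ => (p⁻¹ • ratDerivation d n)^[k] p) := by
  obtain ⟨a, ha⟩ := hd
  have : CharZero (DiffRat F n) := charZero_diffRat
  have : CharZero K := by
    refine ⟨fun i j hij => ?_⟩
    have := congrArg (algebraMap K F) hij
    simpa using this
  set δ := p⁻¹ • ratDerivation d n with hδ
  have hfin : ∀ r : ℕ, 0 < r →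
      AlgebraicIndependent (invariantField d H) (fun j : Fin r => δ^[j] p) := by
    intro r hr
    rw [algebraicIndependent_iff]
    intro Q hQ
    refine (map_injective _ (algebraMap (invariantField d H) (DiffRat F n)).injective) ?_
    rw [map_zero]
    have ht : δ (algebraMap F (DiffRat F n) a) ≠ 0 := by
      rw [hδ, Derivation.smul_apply, ratDerivation_algebraMap, smul_eq_mul]
      exact mul_ne_zero (inv_ne_zero hp.ne_zero) (by simpa using ha)
    refine eq_zero_of_eval_jet_eq_zero δ ht hp.ne_zero hr _ fun c hc => ?_
    have hγ : ∑ k, c k • algebraMap F (DiffRat F n) a ^ (k : ℕ) =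
        algebraMap F (DiffRat F n) (∑ k, c k • a ^ (k : ℕ)) := by
      simp only [map_sum, Algebra.smul_def, map_mul, map_pow,
        ← IsScalarTower.algebraMap_apply K F (DiffRat F n)]
    rw [hγ] at hc ⊢
    set γ := ∑ k, c k • a ^ (k : ℕ)
    have hγ0 : γ ≠ 0 := fun h => hc (by rw [h, map_zero])
    -- The inverse is taken because p is scaled by g⁻¹. The affine part is the identity, which lies
    -- in every H.
    let g : Fˣ := (Units.mk0 γ hγ0)⁻¹
    have hgp : ratSubst d g 1 p = algebraMap F (DiffRat F n) γ * p := by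
      rw [hp.subst_eq g 1 H.one_mem]
      simp [g]
    -- Linearity of the substitution over the invariants lets it carry the relation Q(p, δp, …) = 0
    -- to the jet of γp.
    let σ : DiffRat F n →ₐ[invariantField d H] DiffRat F n :=
      { ratSubst d g 1 with commutes' := fun f => f.2.2 g 1 H.one_mem }
    have hσ : ∀ j : ℕ, δ^[j] (algebraMap F (DiffRat F n) γ * p) = σ (δ^[j] p) := fun j => by
      rw [← hgp]
      exact (hp.ratSubst_iterate g H.one_mem hp.mem j).symm
    simp only [hσ]
    rw [eval_map, ← aeval_def, ← comp_aeval_apply, hQ, map_zero]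
  refine algebraicIndependent_of_finite_type fun t ht => ?_
  obtain ⟨M, hM⟩ := ht.bddAbove
  exact (hfin (M + 1) M.succ_pos).comp
    (fun m : t => (⟨m, Nat.lt_succ_of_le (hM m.2)⟩ : Fin (M + 1)))
    fun m m' h => Subtype.ext (congrArg Fin.val h)

/-- The elements of `F⟨x, d⟩` algebraic over `K(d^j x_i : j < m)`. -/
def jetSpan (K F : Type*) [Field K] [Field F] [Algebra K F] (n m : ℕ) :
    IntermediateField K (DiffRat F n) :=
  algSpan K (Set.range fun q : Fin n × Fin m => ratX F q.1 q.2)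

lemma ratX_mem_jetSpan (i : Fin n) {k m : ℕ} (hk : k < m) : ratX F i k ∈ jetSpan K F n m :=
  subset_algSpan _ ⟨(i, ⟨k, hk⟩), rfl⟩

lemma jetSpan_mono {m m' : ℕ} (h : m ≤ m') : jetSpan K F n m ≤ jetSpan K F n m' := by
  refine algSpan_mono ?_
  rintro _ ⟨⟨i, k⟩, rfl⟩
  exact ⟨(i, ⟨k, k.2.trans_le h⟩), rfl⟩

lemma ratDerivation_mem_jetSpan [CharZero F] (d : Derivation K F F) {m : ℕ} {y : DiffRat F n}
    (hy : y ∈ jetSpan K F n m) : ratDerivation d n y ∈ jetSpan K F n (m + 1) := by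
  have : CharZero (DiffRat F n) := charZero_diffRat
  refine derivation_mem_algSpan _ ?_ ?_ hy
  · rintro _ ⟨⟨i, k⟩, rfl⟩
    exact ratX_mem_jetSpan i (k.2.trans (Nat.lt_succ_self m))
  · rintro _ ⟨⟨i, k⟩, rfl⟩
    rw [ratDerivation_ratX]
    exact ratX_mem_jetSpan i (Nat.add_lt_add_right k.2 1)

lemma exists_mem_jetSpan {y : DiffRat F n} (hy : y ∈ constRat K F n) :
    ∃ m, y ∈ jetSpan K F n m := by
  rw [constRat] at hy
  induction hy using IntermediateField.adjoin_induction with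
  | mem x hx =>
    obtain ⟨⟨i, k⟩, rfl⟩ := hx
    exact ⟨k + 1, ratX_mem_jetSpan i (Nat.lt_succ_self k)⟩
  | algebraMap c => exact ⟨0, IntermediateField.algebraMap_mem _ c⟩
  | add x y _ _ hx hy =>
    obtain ⟨m, hm⟩ := hx
    obtain ⟨m', hm'⟩ := hy
    exact ⟨max m m', add_mem (jetSpan_mono (le_max_left _ _) hm)
      (jetSpan_mono (le_max_right _ _) hm')⟩
  | inv x _ h => exact h.imp fun m hm => inv_mem hm
  | mul x y _ _ hx hy =>
    obtain ⟨m, hm⟩ := hx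
    obtain ⟨m', hm'⟩ := hy
    exact ⟨max m m', mul_mem (jetSpan_mono (le_max_left _ _) hm)
      (jetSpan_mono (le_max_right _ _) hm')⟩

/-- Once m exceeds the order of p, each δ raises the order by at most one, so the shift m does not
grow with k. -/
lemma smul_ratDerivation_iterate_mem_jetSpan [CharZero F] (d : Derivation K F F) {m : ℕ}
    (hp : p ∈ jetSpan K F n m) {y : DiffRat F n} (hy : y ∈ jetSpan K F n m) (k : ℕ) :
    (p⁻¹ • ratDerivation d n)^[k] y ∈ jetSpan K F n (m + k) := by
  induction k with
  | zero => exact hy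
  | succ k ih =>
    rw [Function.iterate_succ_apply', Derivation.smul_apply, smul_eq_mul]
    exact mul_mem (inv_mem (jetSpan_mono (by omega) hp)) (ratDerivation_mem_jetSpan d ih)

/-- The derivatives of n independent invariants and those of p would be jointly independent over K:
growth n + 1 inside growth n. -/
theorem IsNormalizer.not_diffAlgebraicIndependent [CharZero F] (hp : IsNormalizer d H p)
    (hd : ∃ a : F, d a ≠ 0)
    (hL : ∀ f ∈ invariantField d H, (p⁻¹ • ratDerivation d n) f ∈ invariantField d H)
    (f : Fin n → invariantField d H) :
    ¬ DiffAlgebraicIndependent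
      (restrictDerivation (p⁻¹ • ratDerivation d n) (invariantField d H) hL) f := by
  intro hf
  set δ := p⁻¹ • ratDerivation d n
  have hind := AlgebraicIndependent.sumElim_comp hf (hp.algebraicIndependent_iterate hd)
  choose m hm using fun i => exists_mem_jetSpan (f i).2.1
  obtain ⟨m', hm'⟩ := exists_mem_jetSpan hp.mem
  set c := m' + ∑ i, m i
  have hpc : p ∈ jetSpan K F n c := jetSpan_mono (Nat.le_add_right _ _) hm'
  have hfc : ∀ i, (f i : DiffRat F n) ∈ jetSpan K F n c := fun i =>
    jetSpan_mono ((Finset.single_le_sum (fun _ _ => Nat.zero_le _) (Finset.mem_univ i)).trans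
      (Nat.le_add_left _ _)) (hm i)
  -- The count gives (n + 1)N ≤ n(c + N), that is N ≤ nc.
  set N := n * c + 1
  let e : Fin N ⊕ (Fin n × Fin N) → ℕ ⊕ (Fin n × ℕ) :=
    Sum.map Fin.val (Prod.map id Fin.val)
  have he : Function.Injective e :=
    Function.Injective.sumMap Fin.val_injective (Function.injective_id.prodMap Fin.val_injective)
  have hcard := card_le_of_mem_algSpan (hind.comp e he)
    (w := fun q : Fin n × Fin (c + N) => ratX F q.1 q.2) (by
      rintro (k | ⟨i, k⟩)
      · exact jetSpan_mono (by omega) (smul_ratDerivation_iterate_mem_jetSpan d hpc hpc k)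
      · change (((restrictDerivation δ (invariantField d H) hL)^[k] (f i) :
          invariantField d H) : DiffRat F n) ∈ jetSpan K F n (c + N)
        rw [restrictDerivation_iterate]
        exact jetSpan_mono (by omega) (smul_ratDerivation_iterate_mem_jetSpan d hpc (hfc i) k))
  simp only [Fintype.card_sum, Fintype.card_prod, Fintype.card_fin, mul_add] at hcard
  omega

end Substitution

/-! ### The lower bound: an invariant linear equation for x -/

section LowerBound

variable {K F : Type*} [Field K] [Field F] [Algebra K F] {n : ℕ}
variable {d : Derivation K F F} {H : Subgroup (AffineGroup K n)} {p : DiffRat F n}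

/-- If `δ = p⁻¹ D`, the operators `D^(k+1)` are combinations of `δ, …, δ^(k+1)`. -/
lemma iterate_succ_mem_span {E : Type*} [Field E] [Algebra K E] (D : Derivation K E E) {p : E}
    (hp : p ≠ 0) (k : ℕ) :
    (fun y => D^[k + 1] y) ∈ Submodule.span E
      {P : E → E | ∃ i ≤ k, P = fun y => (p⁻¹ • D)^[i + 1] y} := by
  have hD : ∀ y, D y = p * (p⁻¹ • D) y := fun y => by
    rw [Derivation.smul_apply, smul_eq_mul, mul_inv_cancel_left₀ hp]
  induction k with
  | zero =>
    have h : (fun y => D^[0 + 1] y) = p • fun y => (p⁻¹ • D)^[0 + 1] y := by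
      funext y
      exact hD y
    rw [h]
    exact Submodule.smul_mem _ _ (Submodule.subset_span ⟨0, le_refl 0, rfl⟩)
  | succ k ih =>
    -- Composing D with c·P gives c·(D ∘ P) + (Dc)·P; D raises the order in δ by at most one because
    -- D = pδ.
    have key : ∀ P ∈ Submodule.span E {P : E → E | ∃ i ≤ k, P = fun y => (p⁻¹ • D)^[i + 1] y},
        (fun y => D (P y)) ∈ Submodule.span E
          {P : E → E | ∃ i ≤ k + 1, P = fun y => (p⁻¹ • D)^[i + 1] y} := by
      intro P hP
      induction hP using Submodule.span_induction with
      | mem P hP =>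
        obtain ⟨i, hi, rfl⟩ := hP
        have h : (fun y => D ((p⁻¹ • D)^[i + 1] y)) =
            p • fun y => (p⁻¹ • D)^[i + 1 + 1] y := by
          funext y
          rw [Pi.smul_apply, Function.iterate_succ_apply' _ (i + 1), smul_eq_mul]
          exact hD _
        rw [h]
        exact Submodule.smul_mem _ _ (Submodule.subset_span ⟨i + 1, by omega, rfl⟩)
      | zero =>
        have h : (fun y => D ((0 : E → E) y)) = 0 := by funext y; simp
        rw [h]
        exact zero_mem _
      | add P Q _ _ hP hQ =>
        have h : (fun y => D ((P + Q) y)) = (fun y => D (P y)) + fun y => D (Q y) := by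
          funext y; simp
        rw [h]
        exact add_mem hP hQ
      | smul c P hP' hP =>
        have h : (fun y => D ((c • P) y)) = c • (fun y => D (P y)) + D c • P := by
          funext y; simp [mul_comm]
        rw [h]
        refine add_mem (Submodule.smul_mem _ _ hP) (Submodule.smul_mem _ _ ?_)
        exact Submodule.span_mono (fun Q hQ => hQ.imp fun i hi => ⟨by omega, hi.2⟩) hP'
    have h : (fun y => D^[k + 1 + 1] y) = fun y => D ((fun y => D^[k + 1] y) y) := by
      funext y
      rw [Function.iterate_succ_apply']
    rw [h]
    exact key _ ih

/-- The matrix `(δ^(k+1) x_j)`, for `δ = p⁻¹ d`. -/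
def jetMatrix (d : Derivation K F F) (p : DiffRat F n) : Matrix (Fin n) (Fin n) (DiffRat F n) :=
  fun j k => (p⁻¹ • ratDerivation d n)^[k + 1] (ratX F j 0)

/-- A row relation among the δ^(k+1) x_j is also one among the d^(k+1) x_j, since d^(k+1) is a
combination of δ, …, δ^(k+1). But the d^(k+1) x_j are distinct indeterminates, and a generic matrix
is invertible. -/
lemma det_jetMatrix_ne_zero (d : Derivation K F F) (hp : p ≠ 0) : (jetMatrix d p).det ≠ 0 := by
  intro h0
  obtain ⟨u, hu0, hu⟩ := Matrix.exists_vecMul_eq_zero_iff.mpr h0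
  let Λ : (DiffRat F n → DiffRat F n) →ₗ[DiffRat F n] DiffRat F n :=
    ∑ j, u j • LinearMap.proj (ratX F j 0)
  have hΛ : ∀ P, Λ P = ∑ j, u j * P (ratX F j 0) := fun P => by
    simp [Λ, LinearMap.sum_apply]
  have hker : ∀ k < n, Λ (fun y => (ratDerivation d n)^[k + 1] y) = 0 := by
    intro k hk
    have hle : Submodule.span (DiffRat F n) {P : DiffRat F n → DiffRat F n | ∃ i ≤ k,
        P = fun y => (p⁻¹ • ratDerivation d n)^[i + 1] y} ≤ LinearMap.ker Λ := by
      rw [Submodule.span_le]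
      rintro _ ⟨i, hi, rfl⟩
      rw [SetLike.mem_coe, LinearMap.mem_ker, hΛ]
      exact congrFun hu ⟨i, by omega⟩
    exact hle (iterate_succ_mem_span (ratDerivation d n) hp k)
  let e : Fin n × Fin n → Fin n × ℕ := fun q => (q.1, q.2 + 1)
  have he : Function.Injective e := by
    rintro ⟨i, k⟩ ⟨i', k'⟩ h
    simp only [e, Prod.mk.injEq, Nat.add_right_cancel_iff, Fin.val_inj] at h
    exact Prod.ext h.1 h.2
  let ρ : MvPolynomial (Fin n × Fin n) F →+* DiffRat F n :=
    (algebraMap (DiffPoly F n) (DiffRat F n)).comp (rename e : _ →ₐ[F] DiffPoly F n).toRingHom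
  have hρ : Function.Injective ρ :=
    (IsFractionRing.injective (DiffPoly F n) (DiffRat F n)).comp (rename_injective e he)
  have hdet : (ρ.mapMatrix (Matrix.mvPolynomialX (Fin n) (Fin n) F)).det ≠ 0 := by
    rw [← RingHom.map_det]
    exact (map_ne_zero_iff ρ hρ).mpr (Matrix.det_mvPolynomialX_ne_zero (Fin n) F)
  refine hu0 (Matrix.eq_zero_of_vecMul_eq_zero hdet ?_)
  funext k
  have h := hker k k.2
  rw [hΛ] at h
  refine Eq.trans ?_ h
  simp only [Matrix.vecMul, dotProduct]
  refine Finset.sum_congr rfl fun j _ => ?_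
  rw [ratDerivation_iterate_ratX]
  simp [ρ, e, Matrix.mvPolynomialX, ratX]

lemma ratSubst_ratX_zero (g : Fˣ) (T : AffineGroup K n) (j : Fin n) :
    ratSubst d g T (ratX F j 0) = ∑ l, T.linear (Pi.single l 1) j • ratX F l 0 +
      algebraMap K (DiffRat F n) (T 0 j) := by
  have hC : ∀ c : K, algebraMap (DiffPoly F n) (DiffRat F n) (C (algebraMap K F c)) =
      algebraMap K (DiffRat F n) c := fun c => by
    rw [← algebraMap_eq_algebraMap_C, ← IsScalarTower.algebraMap_apply K F (DiffRat F n)]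
  rw [ratX, ratSubst_algebraMap, polySubst, aeval_X]
  simp only [Function.iterate_zero, id, affineCoord, map_add, map_sum, map_mul, hC,
    Algebra.smul_def, ratX]

/-- The translation part is constant and dies under one derivation, which is why the equation for x
starts at δx instead of x. -/
lemma iterate_ratSubst_ratX (δ : Derivation K (DiffRat F n) (DiffRat F n)) (g : Fˣ)
    (T : AffineGroup K n) (j : Fin n) (k : ℕ) :
    δ^[k + 1] (ratSubst d g T (ratX F j 0)) =
      ∑ l, T.linear (Pi.single l 1) j • δ^[k + 1] (ratX F l 0) := by
  rw [ratSubst_ratX_zero, iterate_map_add, derivation_iterate_sum,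
    Function.iterate_succ_apply δ k (algebraMap K _ _), Derivation.map_algebraMap,
    iterate_map_zero, add_zero]
  exact Finset.sum_congr rfl fun l _ => derivation_iterate_smul δ _ _ _

lemma det_toMatrix_linear_ne_zero (T : AffineGroup K n) :
    (LinearMap.toMatrix' (T.linear : (Fin n → K) →ₗ[K] (Fin n → K))).det ≠ 0 := by
  rw [LinearMap.det_toMatrix']
  exact (LinearEquiv.isUnit_det' T.linear).ne_zero

/-- The coordinates of `x` satisfy a linear differential equation
`δ^(n+1) x = a_1 δ x + ⋯ + a_n δ^n x` with invariant coefficients. -/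
theorem IsNormalizer.exists_invariant_equation (hp : IsNormalizer d H p) :
    ∃ a : Fin n → DiffRat F n, (∀ i, a i ∈ invariantField d H) ∧ ∀ j,
      (p⁻¹ • ratDerivation d n)^[n + 1] (ratX F j 0) =
        ∑ k : Fin n, (p⁻¹ • ratDerivation d n)^[(k : ℕ) + 1] (ratX F j 0) * a k := by
  set δ := p⁻¹ • ratDerivation d n with hδ
  have hmem : ∀ k (j : Fin n), δ^[k] (ratX F j 0) ∈ constRat K F n := fun k j =>
    smul_ratDerivation_iterate_mem_constRat hp.mem (ratX_mem_constRat j 0) k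
  have hW := det_jetMatrix_ne_zero d hp.ne_zero
  -- Solved over K⟨x, d⟩ itself, so that the coefficients are known to lie in that field.
  let W : Matrix (Fin n) (Fin n) (constRat K F n) := fun j k => ⟨_, hmem (k + 1) j⟩
  have hWdet : W.det ≠ 0 := by
    intro h
    refine hW ?_
    have : jetMatrix d p = (constRat K F n).val.toRingHom.mapMatrix W := rfl
    rw [this, ← RingHom.map_det, h, map_zero]
  let b : Fin n → constRat K F n := fun j => ⟨_, hmem (n + 1) j⟩
  let a : Fin n → constRat K F n := W⁻¹.mulVec b
  have hWa : W.mulVec a = b := by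
    rw [Matrix.mulVec_mulVec, Matrix.mul_nonsing_inv _ (isUnit_iff_ne_zero.mpr hWdet),
      Matrix.one_mulVec]
  have ha : ∀ j, δ^[n + 1] (ratX F j 0) =
      ∑ k : Fin n, δ^[(k : ℕ) + 1] (ratX F j 0) * (a k : DiffRat F n) := by
    intro j
    have h := congrArg (constRat K F n).val (congrFun hWa j)
    rw [Matrix.mulVec, dotProduct, map_sum] at h
    exact h.symm
  refine ⟨fun i => a i, fun i => ⟨(a i).2, fun g T hT => ?_⟩, ha⟩
  set σ := ratSubst d g T with hσ
  have hσδ : ∀ k (j : Fin n), σ (δ^[k + 1] (ratX F j 0)) =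
      ∑ l, T.linear (Pi.single l 1) j • δ^[k + 1] (ratX F l 0) := fun k j => by
    rw [hσ, hp.ratSubst_iterate g hT (ratX_mem_constRat j 0), iterate_ratSubst_ratX]
  -- The defect of the equation when a is replaced by σ(a). Applying σ to the equation gives h w = 0
  -- with h invertible; subtracting the original equation then gives σ(a) = a, as the jet matrix is
  -- invertible.
  let w : Fin n → DiffRat F n := fun l =>
    δ^[n + 1] (ratX F l 0) - ∑ k : Fin n, δ^[(k : ℕ) + 1] (ratX F l 0) * σ (a k)
  have hw : w = 0 := by
    let h := (algebraMap K (DiffRat F n)).mapMatrix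
      (LinearMap.toMatrix' (T.linear : (Fin n → K) →ₗ[K] (Fin n → K)))
    have hdet : h.det ≠ 0 := by
      rw [← RingHom.map_det]
      exact (map_ne_zero_iff _ (algebraMap K (DiffRat F n)).injective).mpr
        (det_toMatrix_linear_ne_zero T)
    refine Matrix.eq_zero_of_mulVec_eq_zero hdet ?_
    funext j
    have h1 := congrArg σ (ha j)
    simp only [map_sum, map_mul, hσδ] at h1
    have hh : ∀ l, h j l = algebraMap K (DiffRat F n) (T.linear (Pi.single l 1) j) := fun l => by
      simp [h, LinearMap.toMatrix'_apply]
    simp only [Matrix.mulVec, dotProduct, hh, w, Pi.zero_apply, mul_sub, Finset.sum_sub_distrib]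
    simp only [Algebra.smul_def] at h1
    rw [h1, sub_eq_zero]
    simp only [Finset.sum_mul, Finset.mul_sum]
    rw [Finset.sum_comm]
    simp only [mul_assoc]
  have heq : (jetMatrix d p).mulVec (fun k => σ (a k) - a k) = 0 := by
    funext j
    have h1 := congrFun hw j
    simp only [w, Pi.zero_apply, ha j] at h1
    simp only [Matrix.mulVec, dotProduct, jetMatrix, mul_sub, Finset.sum_sub_distrib, Pi.zero_apply]
    rw [← neg_eq_zero, neg_sub]
    exact h1
  exact sub_eq_zero.mp (congrFun (Matrix.eq_zero_of_mulVec_eq_zero hW heq) i)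

/-- The invariants contain `n - 1` differentially independent elements: the coefficients of the
invariant equation for `x`, together with `p`, determine `x` up to finitely many constants of
integration. -/
theorem IsNormalizer.exists_diffAlgebraicIndependent [CharZero F] (hp : IsNormalizer d H p) :
    ∃ (S : Finset (Fin n)) (a : Fin n → DiffRat F n), (∀ i, a i ∈ invariantField d H) ∧
      n ≤ S.card + 1 ∧
      DiffAlgebraicIndependent (p⁻¹ • ratDerivation d n) (fun i : S => a i) := by
  have : CharZero (DiffRat F n) := charZero_diffRat
  obtain ⟨a, ha, heq⟩ := hp.exists_invariant_equation
  set δ := p⁻¹ • ratDerivation d n with hδ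
  obtain ⟨S, R, hS, hspan⟩ := exists_diffAlgebraicIndependent_spanning δ a
  refine ⟨S, a, ha, ?_, hS⟩
  let G : ℕ → Set (DiffRat F n) := fun N => {y | (∃ i, ∃ k ≤ N, y = δ^[k] (a i)) ∨
    (∃ k ≤ N, y = δ^[k] p) ∨ ∃ j : Fin n, ∃ k ≤ n, y = δ^[k] (ratX F j 0)}
  -- The only derivative of a generator that leaves the list is δ^(n+1) x_j, and the invariant
  -- equation expresses it through the list.
  have hδG : ∀ N, ∀ y ∈ algSpan K (G N), δ y ∈ algSpan K (G (N + 1)) := by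
    intro N y hy
    refine derivation_mem_algSpan δ (Set.Subset.trans ?_ (subset_algSpan _)) ?_ hy
    · rintro y (⟨i, k, hk, rfl⟩ | ⟨k, hk, rfl⟩ | ⟨j, k, hk, rfl⟩)
      · exact Or.inl ⟨i, k, by omega, rfl⟩
      · exact Or.inr (Or.inl ⟨k, by omega, rfl⟩)
      · exact Or.inr (Or.inr ⟨j, k, hk, rfl⟩)
    · rintro y (⟨i, k, hk, rfl⟩ | ⟨k, hk, rfl⟩ | ⟨j, k, hk, rfl⟩)
      · exact subset_algSpan _
          (Or.inl ⟨i, k + 1, by omega, (Function.iterate_succ_apply' _ _ _).symm⟩)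
      · exact subset_algSpan _
          (Or.inr (Or.inl ⟨k + 1, by omega, (Function.iterate_succ_apply' _ _ _).symm⟩))
      · rw [← Function.iterate_succ_apply' δ]
        rcases Nat.lt_or_ge k n with hkn | hkn
        · exact subset_algSpan _ (Or.inr (Or.inr ⟨j, k + 1, hkn, rfl⟩))
        · obtain rfl : k = n := le_antisymm hk hkn
          rw [Nat.succ_eq_add_one, heq]
          refine sum_mem fun l _ => mul_mem ?_ ?_
          · exact subset_algSpan _ (Or.inr (Or.inr ⟨j, l + 1, l.2, rfl⟩))
          · exact subset_algSpan _ (Or.inl ⟨l, 0, Nat.zero_le _, rfl⟩)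
  have hX : ∀ m (j : Fin n), ratX F j m ∈ algSpan K (G m) := by
    intro m j
    induction m with
    | zero => exact subset_algSpan _ (Or.inr (Or.inr ⟨j, 0, Nat.zero_le _, rfl⟩))
    | succ m ih =>
      have h : ratX F j (m + 1) = p * δ (ratX F j m) := by
        rw [hδ, Derivation.smul_apply, smul_eq_mul, mul_inv_cancel_left₀ hp.ne_zero,
          ratDerivation_ratX]
      rw [h]
      exact mul_mem (subset_algSpan _ (Or.inr (Or.inl ⟨0, Nat.zero_le _, rfl⟩))) (hδG m _ ih)
  -- The count reads n(N + 1) ≤ (|S| + 1)(N + 1) + nR + n(n + 1). With this N the error is less than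
  -- N + 1, so |S| + 2 ≤ n is impossible.
  set N := n * R + n * (n + 1) with hN
  let w : (S × Fin (N + 1) ⊕ Fin n × Fin R) ⊕ (Fin (N + 1) ⊕ Fin n × Fin (n + 1)) → DiffRat F n :=
    Sum.elim (Sum.elim (fun q => δ^[q.2] (a q.1)) (fun q => δ^[q.2] (a q.1)))
      (Sum.elim (fun k => δ^[k] p) (fun q => δ^[q.2] (ratX F q.1 0)))
  have hG : algSpan K (G N) ≤ algSpan K (Set.range w) := by
    refine algSpan_le ?_
    rintro y (⟨i, k, hk, rfl⟩ | ⟨k, hk, rfl⟩ | ⟨j, k, hk, rfl⟩)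
    · refine algSpan_mono ?_ (hspan N k hk i)
      rintro _ (⟨q, rfl⟩ | ⟨q, rfl⟩)
      · exact ⟨Sum.inl (Sum.inl q), rfl⟩
      · exact ⟨Sum.inl (Sum.inr q), rfl⟩
    · exact subset_algSpan _ ⟨Sum.inr (Sum.inl ⟨k, Nat.lt_succ_of_le hk⟩), rfl⟩
    · exact subset_algSpan _ ⟨Sum.inr (Sum.inr (j, ⟨k, Nat.lt_succ_of_le hk⟩)), rfl⟩
  have hGmono : ∀ m ≤ N, algSpan K (G m) ≤ algSpan K (G N) := fun m hm => by
    refine algSpan_mono ?_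
    rintro y (⟨i, k, hk, rfl⟩ | ⟨k, hk, rfl⟩ | ⟨j, k, hk, rfl⟩)
    · exact Or.inl ⟨i, k, hk.trans hm, rfl⟩
    · exact Or.inr (Or.inl ⟨k, hk.trans hm, rfl⟩)
    · exact Or.inr (Or.inr ⟨j, k, hk, rfl⟩)
  have hcard := card_le_of_mem_algSpan
    ((algebraicIndependent_ratX (K := K) (F := F) (n := n)).comp
      (Prod.map id Fin.val : Fin n × Fin (N + 1) → Fin n × ℕ)
      (Function.injective_id.prodMap Fin.val_injective)) (w := w)
    (fun q => hG (hGmono q.2 (Nat.le_of_lt_succ q.2.2) (hX q.2 q.1)))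
  simp only [Fintype.card_sum, Fintype.card_prod, Fintype.card_fin, Fintype.card_coe] at hcard
  by_contra hlt
  have h2 : (S.card + 2) * (N + 1) ≤ n * (N + 1) := Nat.mul_le_mul_right _ (by omega)
  have h3 : (S.card + 2) * (N + 1) = S.card * (N + 1) + (N + 1) + (N + 1) := by ring
  omega

end LowerBound
end
end DiffInvariants

/-! ### The two bounds combined -/

theorem theorem2 {K F : Type*} [Field K] [Field F] [CharZero F] [Algebra K F]
    (d : Derivation K F F)
    (hK : ∀ a : F, d a = 0 → a ∈ (algebraMap K F).range)
    (hd : ∃ a : F, d a ≠ 0)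
    (n : ℕ) (hn : 1 < n)
    (H : Subgroup (DiffInvariants.AffineGroup K n))
    (p : DiffInvariants.DiffRat F n) (hp : DiffInvariants.IsNormalizer d H p) :
    ∃ hδ : ∀ f ∈ DiffInvariants.invariantField d H,
        (p⁻¹ • DiffInvariants.ratDerivation d n) f ∈ DiffInvariants.invariantField d H,
      DiffInvariants.diffTrdeg
        (DiffInvariants.restrictDerivation (p⁻¹ • DiffInvariants.ratDerivation d n)
          (DiffInvariants.invariantField d H) hδ) = ((n - 1 : ℕ) : Cardinal) := by
  have hδ : ∀ f ∈ DiffInvariants.invariantField d H,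
      (p⁻¹ • DiffInvariants.ratDerivation d n) f ∈ DiffInvariants.invariantField d H :=
    fun f hf => hp.smul_ratDerivation_mem_invariantField hf
  refine ⟨hδ, le_antisymm ?_ ?_⟩
  · obtain ⟨m, rfl⟩ := Nat.exists_eq_succ_of_ne_zero (Nat.ne_zero_of_lt hn)
    exact DiffInvariants.diffTrdeg_le fun f => hp.not_diffAlgebraicIndependent hd hδ f
  · obtain ⟨S, a, ha, hcard, hind⟩ := hp.exists_diffAlgebraicIndependent
    have h := DiffInvariants.le_diffTrdeg
      ((DiffInvariants.diffAlgebraicIndependent_restrictDerivation _ _ hδ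
        (fun i : S => (⟨a i, ha i⟩ : DiffInvariants.invariantField d H))).mpr hind)
    rw [Fintype.card_coe] at h
    exact le_trans (by exact_mod_cast (by omega : n - 1 ≤ S.card)) h
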